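/- **Setting.** Let $n\ge 1$, $0<\lambda\le\Lambda<\infty$, $a\ge 1$, $0<\underline\sigma\le\overline\sigma<2$, and let $\varphi:(0,\infty)\to(0,\infty)$ be a measurable function satisfying $$a^{-1}\Big(\frac{s}{r}\Big)^{\underline\sigma}\le\frac{\varphi(s)}{\varphi(r)}\le a\Big(\frac{s}{r}\Big)^{\overline\sigma}\qquad\text{for all }0<r\le s<\infty .$$ Put $$C_\varphi=\Big(\int_{\mathbb R^n}\frac{1-\cos y_1}{|y|^n\varphi(|y|)}\,dy\Big)^{-1},\qquad \underline C(t)=\int_0^t\frac{r}{\varphi(r)}\,dr,\qquad \overline C(t)=\int_t^\infty\frac{dr}{r\varphi(r)},$$ and $\underline C=\underline C(1)$, $\overline C=\overline C(1)$. Let $\mathcal L_0$ be the class of operators $Lu(x)=\int_{\mathbb R^n}\big(u(x+y)+u(x-y)-2u(x)\big)K(y)\,dy$ with measurable symmetric kernels $K$ such that $\int\frac{|y|^2}{1+|y|^2}K(y)\,dy<\infty$ and $$C_\varphi\frac{\lambda}{|y|^n\varphi(|y|)}\le K(y)\le C_\varphi\frac{\Lambda}{|y|^n\varphi(|y|)}\qquad(y\ne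 0),$$ and let $\mathcal M^+u(x)=\sup_{L\in\mathcal L_0}Lu(x)$. For an open set $\Omega$ and a function $g$ on $\Omega$, a bounded measurable function $u:\mathbb R^n\to\mathbb R$ that is upper semicontinuous in $\overline\Omega$ satisfies $\mathcal M^+u\ge g$ in $\Omega$ in the viscosity sense if, whenever $x\in\Omega$, $N\subset\Omega$ is a bounded open neighbourhood of $x$ and $\psi$ is a $C^2$ function with $\psi(x)=u(x)$ and $\psi>u$ in $N\setminus\{x\}$, the function $v$ equal to $\psi$ in $N$ and to $u$ in $\mathbb R^n\setminus N$ satisfies $\mathcal M^+v(x)\ge g(x)$. Let $R>0$ and $B_R=B_R(0)$. The concave envelope $\Gamma$ of $u^+$ in $B_{3R}$ is $\Gamma(x)=\min\{p(x): p\text{ affine},\ p\ge u^+\text{ in }B_{3R}\}$ for $x\in B_{3R}$ and $\Gamma=0$ outside $B_{3R}$. For $S\subset B_{3R}$, $\nabla\Gamma(S)$ is the union over $x\in S$ of the superdifferentials $\{p:\Gamma(y)\le\Gamma(x)+p\cdot(y-x)\ \forall y\in B_{3R}\}$. The contact set is $\Sigma=\{x\in B_R:u(x)=\Gamma(x)\}$.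 Let $$r_0=\rho_0\,2^{-1/(2-\underline\sigma)}R,\qquad \rho_0=2^{-8}n^{-1}.$$ For a cube $\mathcal Q$ and $t>0$, $t\mathcal Q$ is the cube with the same centre and $t$ times the side length. **Theorem (ABP estimate).** There are constants $\mu_n\in(0,1)$, depending only on $n$, and $C>0$, depending only on $n$, $\lambda$ and $a$, such that the following holds. Let $f$ be a real function, bounded above in $B_R$, and suppose that $\mathcal M^+u\ge -f$ in $B_R$ in the viscosity sense, that $u\le 0$ in $\mathbb R^n\setminus B_R$, and that $u$ is positive at some point. Then there is a finite family of pairwise disjoint open cubes $\mathcal Q_1,\dots,\mathcal Q_m$ with diameters $d_j\le r_0$ such that, with $M_j=\sup_{\overline{\mathcal Q}_j\cap B_R}f$, 1. $\Sigma\cap\overline{\mathcal Q}_j\ne\emptyset$ for every $j$; 2. $\Sigma\subset\bigcup_{j=1}^m\overline{\mathcal Q}_j$; 3. $|\nabla\Gamma(\overline{\mathcal Q}_j)|\le C\Big(\dfrac{\underline C+\overline C}{\underline C(r_0)}\,M_j\Big)^n|\mathcal Q_j|$ for every $j$; 4. $\Big|\Big\{y\in 32\sqrt n\,\mathcal Q_j:\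 u(y)>\Gamma(y)-C\,\dfrac{\underline C+\overline C}{\underline C(r_0)}\,M_j\,d_j^2\Big\}\Big|\ge\mu_n|\mathcal Q_j|$ for every $j$. -/

import Mathlib

namespace NonlocalABP

/-- `ℝⁿ` with its Euclidean norm. -/
abbrev E (n : ℕ) : Type := EuclideanSpace ℝ (Fin n)

/-- The weak scaling condition for a (measurable) function `φ : (0, ∞) → (0, ∞)` with constants
`a`, `σ₁` (lower exponent) and `σ₂` (upper exponent). Only the values of `φ` on `(0, ∞)` matter. -/
structure WeakScaling (φ : ℝ → ℝ) (a σ₁ σ₂ : ℝ) : Prop where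
  measurable : Measurable (fun r : Set.Ioi (0 : ℝ) => φ r)
  pos : ∀ r, 0 < r → 0 < φ r
  lower : ∀ r R, 0 < r → r ≤ R → a⁻¹ * (R / r) ^ σ₁ ≤ φ R / φ r
  upper : ∀ r R, 0 < r → r ≤ R → φ R / φ r ≤ a * (R / r) ^ σ₂

/-- `∫₀ᴿ r / φ(r) dr`. -/
noncomputable def lowerC (φ : ℝ → ℝ) (R : ℝ) : ℝ :=
  ∫ r in Set.Ioo 0 R, r / φ r

/-- `∫_R^∞ 1 / (r φ(r)) dr`. -/
noncomputable def upperC (φ : ℝ → ℝ) (R : ℝ) : ℝ :=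
  ∫ r in Set.Ioi R, 1 / (r * φ r)

/-- The normalizing constant `C_φ = (∫ (1 - cos y₁) / (|y|ⁿ φ(|y|)) dy)⁻¹`. -/
noncomputable def normConst (n : ℕ) [NeZero n] (φ : ℝ → ℝ) : ℝ :=
  (∫ y : E n, (1 - Real.cos (y 0)) / (‖y‖ ^ n * φ ‖y‖))⁻¹

/-- The second difference `δ(u, x, y) = u(x + y) + u(x - y) - 2 u(x)`. -/
def secondDiff {n : ℕ} (u : E n → ℝ) (x y : E n) : ℝ :=
  u (x + y) + u (x - y) - 2 * u x

/-- The linear operator `L u(x) = ∫ δ(u, x, y) K(y) dy`. -/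
noncomputable def linOp {n : ℕ} (K : E n → ℝ) (u : E n → ℝ) (x : E n) : ℝ :=
  ∫ y, secondDiff u x y * K y

/-- The kernels of the class `𝓛₀`: symmetric, with `∫ |y|² / (1 + |y|²) K(y) dy < ∞`, and comparable
to `C_φ / (|y|ⁿ φ(|y|))` with constants `lam` and `Lam`. -/
structure IsKernel {n : ℕ} [NeZero n] (φ : ℝ → ℝ) (lam Lam : ℝ) (K : E n → ℝ) : Prop where
  measurable : Measurable K
  symm : ∀ y, K (-y) = K y
  integrable : MeasureTheory.Integrable (fun y : E n => ‖y‖ ^ 2 / (1 + ‖y‖ ^ 2) * K y)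
  lower : ∀ y, y ≠ 0 → normConst n φ * (lam / (‖y‖ ^ n * φ ‖y‖)) ≤ K y
  upper : ∀ y, y ≠ 0 → K y ≤ normConst n φ * (Lam / (‖y‖ ^ n * φ ‖y‖))

/-- The maximal operator `𝓜⁺ u(x) = sup_{L ∈ 𝓛₀} L u(x)`. -/
noncomputable def maxOp {n : ℕ} [NeZero n] (φ : ℝ → ℝ) (lam Lam : ℝ) (u : E n → ℝ) (x : E n) : ℝ :=
  sSup {t : ℝ | ∃ K : E n → ℝ, IsKernel φ lam Lam K ∧ t = linOp K u x}

/-- `I u ≥ g` in `Ω` in the viscosity sense: `u` is a bounded (Lebesgue measurable) function on `ℝⁿ`,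
upper semicontinuous in `closure Ω`, and whenever a `C²` function `ψ` touches `u` strictly from above
at `x ∈ Ω` in a bounded open neighbourhood `N ⊆ Ω` of `x`, the function `v` equal to `ψ` in `N` and
to `u` outside `N` satisfies `I v(x) ≥ g(x)`. -/
structure IsViscositySubsolution {n : ℕ} (I : (E n → ℝ) → E n → ℝ) (g : E n → ℝ) (Ω : Set (E n))
    (u : E n → ℝ) : Prop where
  aemeasurable : AEMeasurable u MeasureTheory.volume
  bounded : ∃ M : ℝ, ∀ x, |u x| ≤ M
  usc : UpperSemicontinuousOn u (closure Ω)
  test : ∀ x ∈ Ω, ∀ N : Set (E n), IsOpen N → x ∈ N → Bornology.IsBounded N → N ⊆ Ω →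
    ∀ ψ : E n → ℝ, ContDiff ℝ 2 ψ → ψ x = u x → (∀ y ∈ N \ {x}, u y < ψ y) →
    ∀ v : E n → ℝ, (∀ y ∈ N, v y = ψ y) → (∀ y ∉ N, v y = u y) → g x ≤ I v x

open Classical in
/-- The concave envelope of `u⁺` in the ball `B_{3R}`: the least value of the planes lying above `u⁺`
in `B_{3R}`, and `0` outside `B_{3R}`. -/
noncomputable def concaveEnvelope {n : ℕ} (u : E n → ℝ) (R : ℝ) (x : E n) : ℝ :=
  if x ∈ Metric.ball (0 : E n) (3 * R) then
    sInf {t : ℝ | ∃ (p : E n) (c : ℝ),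
      (∀ y ∈ Metric.ball (0 : E n) (3 * R), max (u y) 0 ≤ inner ℝ p y + c) ∧ t = inner ℝ p x + c}
  else 0

/-- The contact set `{u = Γ} ∩ B_R`. -/
def contactSet {n : ℕ} (u : E n → ℝ) (R : ℝ) : Set (E n) :=
  {x | x ∈ Metric.ball (0 : E n) R ∧ u x = concaveEnvelope u R x}

/-- The image `∇Γ(S)` of `S` under the superdifferential in `U` of a function `Γ` (concave in `U`). -/
def gradImage {n : ℕ} (Γ : E n → ℝ) (U S : Set (E n)) : Set (E n) :=
  {p | ∃ x ∈ S ∩ U, ∀ y ∈ U, Γ y ≤ Γ x + inner ℝ p (y - x)}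

/-- The open cube with centre `c` and side length `s`, with sides parallel to the axes. -/
def cube {n : ℕ} (c : E n) (s : ℝ) : Set (E n) :=
  {y | ∀ i, |y i - c i| < s / 2}

/-- `r₀ = ρ₀ 2^{-1/(2 - σ₁)} R` with `ρ₀ = 2⁻⁸ n⁻¹`. -/
noncomputable def r0 (n : ℕ) (σ₁ R : ℝ) : ℝ :=
  1 / (2 ^ 8 * (n : ℝ)) * (2 : ℝ) ^ (-1 / (2 - σ₁)) * R

/-- The factor `(C̲(1) + C̄(1)) / C̲(r₀)`. -/
noncomputable def scaleFactor (n : ℕ) (φ : ℝ → ℝ) (σ₁ R : ℝ) : ℝ :=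
  (lowerC φ 1 + upperC φ 1) / lowerC φ (r0 n σ₁ R)

end NonlocalABP

/-!
At a contact point `x` a plane touches `u` from above, so every second difference `δ(u, x, ·)` is
nonpositive, the inequality `𝓜⁺u ≥ -f` holds classically at `x`, and it bounds the integral of
`-δ(u, x, y)` against the radial kernel by a multiple of `f x`. Splitting `B_T` into dyadic annuli,
on at least one of them, of radius `r` say, `u` lies within `C A f(x) r²` of the plane outside a
small set, where `A = (C̲ + C̄) / C̲(T)`: otherwise the annuli would together contribute more than
the whole integral. Since each point near `x` is the midpoint of two good points of that annulus,
concavity keeps the envelope `Γ` equally close to the plane near `x`. This confines the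
superdifferentials of `Γ` near `x` to a ball of radius `C A f(x) r` and keeps `u` close to `Γ`
outside a small set, which are the two estimates for every cube of diameter comparable to `r` whose
closure contains `x`. Starting from a grid, the dyadic cubes are subdivided until the estimates
hold; as the contact set is compact, this stops after finitely many steps.
-/

namespace NonlocalABP

open MeasureTheory Set Metric Filter Topology Function

/-- The volume of the unit ball of `ℝⁿ`. -/
noncomputable def unitBallVolume (n : ℕ) : ℝ := volume.real (ball (0 : E n) 1)

theorem unitBallVolume_pos (n : ℕ) : 0 < unitBallVolume n :=
  ENNReal.toReal_pos (measure_ball_pos volume 0 one_pos).ne' measure_ball_lt_top.ne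

theorem volume_ball_eq {n : ℕ} (x : E n) {r : ℝ} (hr : 0 < r) :
    volume (ball x r) = ENNReal.ofReal (r ^ n * unitBallVolume n) := by
  rw [Measure.addHaar_ball_of_pos volume x hr, finrank_euclideanSpace_fin,
    ENNReal.ofReal_mul (by positivity), unitBallVolume, ofReal_measureReal]

theorem volume_closedBall_eq {n : ℕ} (x : E n) {r : ℝ} (hr : 0 ≤ r) :
    volume (closedBall x r) = ENNReal.ofReal (r ^ n * unitBallVolume n) := by
  rw [Measure.addHaar_closedBall volume x hr, finrank_euclideanSpace_fin,
    ENNReal.ofReal_mul (by positivity), unitBallVolume, ofReal_measureReal]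

/-- The reference kernel `1 / (|y|ⁿ φ(|y|))`. -/
noncomputable def radialKernel (n : ℕ) (φ : ℝ → ℝ) (y : E n) : ℝ :=
  1 / (‖y‖ ^ n * φ ‖y‖)

namespace WeakScaling

variable {φ : ℝ → ℝ} {a σ₁ σ₂ : ℝ}

theorem one_le (h : WeakScaling φ a σ₁ σ₂) : 1 ≤ a := by
  simpa [(h.pos 1 one_pos).ne'] using h.upper 1 1 one_pos le_rfl

theorem inv_le_of_le_right (h : WeakScaling φ a σ₁ σ₂) {r s : ℝ} (hr : 0 < r) (hrs : r ≤ s) :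
    (φ r)⁻¹ ≤ a * (s / r) ^ σ₂ / φ s := by
  rw [le_div_iff₀ (h.pos s (hr.trans_le hrs)), ← div_eq_inv_mul]
  exact h.upper r s hr hrs

theorem inv_le_of_le_left (h : WeakScaling φ a σ₁ σ₂) {r s : ℝ} (hr : 0 < r) (hrs : r ≤ s) :
    (φ s)⁻¹ ≤ a * (s / r) ^ (-σ₁) / φ r := by
  have hs := hr.trans_le hrs
  have hφr := h.pos r hr
  have := h.pos s hs
  have := one_pos.trans_le h.one_le
  have : 0 < (s / r) ^ σ₁ := Real.rpow_pos_of_pos (div_pos hs hr) _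
  have hlow := h.lower r s hr hrs
  rw [le_div_iff₀ hφr] at hlow
  rw [Real.rpow_neg (div_pos hs hr).le]
  calc (φ s)⁻¹ ≤ (a⁻¹ * (s / r) ^ σ₁ * φ r)⁻¹ := by gcongr
    _ = a * ((s / r) ^ σ₁)⁻¹ / φ r := by field_simp

theorem le_mul_of_le (h : WeakScaling φ a σ₁ σ₂) (h1 : 0 ≤ σ₁) {r s : ℝ} (hr : 0 < r)
    (hrs : r ≤ s) : φ r ≤ a * φ s := by
  have hφr := h.pos r hr
  have hφs := h.pos s (hr.trans_le hrs)
  have ha := one_pos.trans_le h.one_le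
  have hpow : (s / r) ^ (-σ₁) ≤ 1 :=
    Real.rpow_le_one_of_one_le_of_nonpos ((one_le_div hr).2 hrs) (by linarith)
  have hinv : (φ s)⁻¹ ≤ a / φ r := calc
    (φ s)⁻¹ ≤ a * (s / r) ^ (-σ₁) / φ r := h.inv_le_of_le_left hr hrs
    _ ≤ a * 1 / φ r := by gcongr
    _ = a / φ r := by rw [mul_one]
  rwa [inv_le_iff_one_le_mul₀ hφs, mul_comm, ← mul_div_assoc, one_le_div hφr, mul_comm] at hinv

theorem le_four_mul_of_le_two_mul (h : WeakScaling φ a σ₁ σ₂) (h2 : σ₂ ≤ 2) {r s : ℝ}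
    (hr : 0 < r) (hrs : r ≤ s) (hsr : s ≤ 2 * r) : φ s ≤ 4 * a * φ r := by
  have hφr := h.pos r hr
  have ha := one_pos.trans_le h.one_le
  have hpow : (s / r) ^ σ₂ ≤ 4 := calc
    (s / r) ^ σ₂ ≤ (s / r) ^ (2 : ℝ) := Real.rpow_le_rpow_of_exponent_le ((one_le_div hr).2 hrs) h2
    _ = (s / r) ^ 2 := Real.rpow_two _
    _ ≤ 2 ^ 2 := by
      have : s / r ≤ 2 := (div_le_iff₀ hr).2 hsr
      have : 0 ≤ s / r := div_nonneg (hr.le.trans hrs) hr.le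
      gcongr
    _ = 4 := by norm_num
  calc φ s ≤ a * (s / r) ^ σ₂ * φ r := (div_le_iff₀ hφr).1 (h.upper r s hr hrs)
    _ ≤ a * 4 * φ r := by gcongr
    _ = 4 * a * φ r := by ring

theorem aemeasurable_restrict (h : WeakScaling φ a σ₁ σ₂) {s : Set ℝ} (hs : s ⊆ Ioi 0) :
    AEMeasurable φ (volume.restrict s) :=
  (aemeasurable_restrict_of_measurable_subtype measurableSet_Ioi h.measurable).mono_set hs

theorem integrableOn_Ioo_div (h : WeakScaling φ a σ₁ σ₂) (h2 : σ₂ < 2) (T : ℝ) :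
    IntegrableOn (fun r => r / φ r) (Ioo 0 T) := by
  rcases le_or_gt T 0 with hT | hT
  · simp [Ioo_eq_empty_of_le hT]
  have hdom : IntegrableOn (fun r : ℝ => a * T ^ σ₂ / φ T * r ^ (1 - σ₂)) (Ioo 0 T) :=
    ((intervalIntegral.integrableOn_Ioo_rpow_iff hT).2 (by linarith)).const_mul _
  refine hdom.mono'
    (aemeasurable_id.div (h.aemeasurable_restrict fun r hr => hr.1)).aestronglyMeasurable ?_
  refine (ae_restrict_mem measurableSet_Ioo).mono fun r ⟨hr, hrT⟩ => ?_
  have hφr := h.pos r hr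
  rw [Real.norm_of_nonneg (by positivity), Real.rpow_sub hr, Real.rpow_one]
  calc r / φ r = r * (φ r)⁻¹ := div_eq_mul_inv _ _
    _ ≤ r * (a * (T / r) ^ σ₂ / φ T) := by
      gcongr
      exact h.inv_le_of_le_right hr hrT.le
    _ = a * T ^ σ₂ / φ T * (r / r ^ σ₂) := by
      rw [Real.div_rpow hT.le hr.le]
      ring

theorem integrableOn_Ioi_one_div (h : WeakScaling φ a σ₁ σ₂) (h1 : 0 < σ₁) {T : ℝ} (hT : 0 < T) :
    IntegrableOn (fun r => 1 / (r * φ r)) (Ioi T) := by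
  have hdom : IntegrableOn (fun r : ℝ => a * T ^ σ₁ / φ T * r ^ (-1 - σ₁)) (Ioi T) :=
    (integrableOn_Ioi_rpow_of_lt (by linarith) hT).const_mul _
  refine hdom.mono' ((aemeasurable_id.mul (h.aemeasurable_restrict
    fun r hr => hT.trans (mem_Ioi.1 hr))).const_div 1).aestronglyMeasurable ?_
  refine (ae_restrict_mem measurableSet_Ioi).mono fun r hTr => ?_
  have hr : 0 < r := hT.trans hTr
  have hφr := h.pos r hr
  rw [Real.norm_of_nonneg (by positivity), Real.rpow_sub hr, Real.rpow_neg_one]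
  calc 1 / (r * φ r) = r⁻¹ * (φ r)⁻¹ := by rw [one_div, mul_inv]
    _ ≤ r⁻¹ * (a * (r / T) ^ (-σ₁) / φ T) := by
      gcongr
      exact h.inv_le_of_le_left hT (mem_Ioi.1 hTr).le
    _ = a * T ^ σ₁ / φ T * (r⁻¹ / r ^ σ₁) := by
      rw [Real.rpow_neg (by positivity), Real.div_rpow hr.le hT.le]
      have := (Real.rpow_pos_of_pos hT σ₁).ne'
      field_simp

theorem lowerC_pos (h : WeakScaling φ a σ₁ σ₂) (h2 : σ₂ < 2) {T : ℝ} (hT : 0 < T) :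
    0 < lowerC φ T := by
  have hpos : ∀ r ∈ Ioo 0 T, 0 < r / φ r := fun r hr => div_pos hr.1 (h.pos r hr.1)
  rw [lowerC, setIntegral_pos_iff_support_of_nonneg_ae
    ((ae_restrict_mem measurableSet_Ioo).mono fun r hr => (hpos r hr).le)
    (h.integrableOn_Ioo_div h2 T)]
  calc (0 : ENNReal) < volume (Ioo 0 T) := by simpa using hT
    _ ≤ volume (Function.support (fun r => r / φ r) ∩ Ioo 0 T) :=
      measure_mono fun r hr => ⟨(hpos r hr).ne', hr⟩

theorem upperC_nonneg (h : WeakScaling φ a σ₁ σ₂) {T : ℝ} (hT : 0 ≤ T) : 0 ≤ upperC φ T := by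
  refine setIntegral_nonneg measurableSet_Ioi fun r hr => ?_
  have hr0 : 0 < r := hT.trans_lt hr
  have := h.pos r hr0
  positivity

theorem radialKernel_nonneg (h : WeakScaling φ a σ₁ σ₂) {n : ℕ} [NeZero n] (y : E n) :
    0 ≤ radialKernel n φ y := by
  obtain rfl | hy := eq_or_ne y 0
  · simp [radialKernel, NeZero.ne n]
  · have := h.pos ‖y‖ (norm_pos_iff.2 hy)
    unfold radialKernel
    positivity

theorem radialKernel_pos (h : WeakScaling φ a σ₁ σ₂) {n : ℕ} {y : E n} (hy : y ≠ 0) :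
    0 < radialKernel n φ y := by
  have := h.pos ‖y‖ (norm_pos_iff.2 hy)
  unfold radialKernel
  positivity

theorem measurable_radialKernel (h : WeakScaling φ a σ₁ σ₂) (n : ℕ) [NeZero n] :
    Measurable (radialKernel n φ) := by
  have hind : Measurable ((Ioi (0 : ℝ)).indicator φ) := by
    refine measurable_of_restrict_of_restrict_compl (s := Ioi (0 : ℝ)) measurableSet_Ioi ?_ ?_
    · convert h.measurable using 1
      ext x
      simp [Set.domRestrict]
    · convert measurable_const (a := (0 : ℝ)) using 1
      ext x
      have : (x : ℝ) ∉ Ioi (0 : ℝ) := x.2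
      simp [Set.domRestrict, indicator_of_notMem this]
  have heq : radialKernel n φ = fun y => 1 / (‖y‖ ^ n * (Ioi (0 : ℝ)).indicator φ ‖y‖) := by
    ext y
    obtain rfl | hy := eq_or_ne y 0
    · simp [radialKernel, NeZero.ne n]
    · rw [radialKernel, indicator_of_mem (by simpa using hy)]
  rw [heq]
  exact ((measurable_norm.pow_const n).mul (hind.comp measurable_norm)).const_div 1

end WeakScaling

section RadialIntegral

variable {φ : ℝ → ℝ} {a σ₁ σ₂ : ℝ}

theorem eqOn_Ioc_min_sq_one_div :
    EqOn (fun r => min (r ^ 2) 1 / (r * φ r)) (fun r => r / φ r) (Ioc 0 1) := by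
  intro r ⟨hr, hr1⟩
  simp only [min_eq_left (pow_le_one₀ hr.le hr1 : r ^ 2 ≤ 1)]
  rw [sq, mul_div_mul_left _ _ hr.ne']

theorem eqOn_Ioi_min_sq_one_div :
    EqOn (fun r => min (r ^ 2) 1 / (r * φ r)) (fun r => 1 / (r * φ r)) (Ioi 1) := by
  intro r hr
  simp only [min_eq_right (one_le_pow₀ (mem_Ioi.1 hr).le : 1 ≤ r ^ 2)]

theorem WeakScaling.integrableOn_Ioi_min_sq_one_div (h : WeakScaling φ a σ₁ σ₂) (h1 : 0 < σ₁)
    (h2 : σ₂ < 2) : IntegrableOn (fun r => min (r ^ 2) 1 / (r * φ r)) (Ioi 0) := by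
  rw [← Ioc_union_Ioi_eq_Ioi zero_le_one, integrableOn_union,
    integrableOn_congr_fun eqOn_Ioc_min_sq_one_div measurableSet_Ioc,
    integrableOn_congr_fun eqOn_Ioi_min_sq_one_div measurableSet_Ioi,
    integrableOn_Ioc_iff_integrableOn_Ioo]
  exact ⟨h.integrableOn_Ioo_div h2 1, h.integrableOn_Ioi_one_div h1 one_pos⟩

theorem WeakScaling.setIntegral_Ioi_min_sq_one_div (h : WeakScaling φ a σ₁ σ₂) (h1 : 0 < σ₁)
    (h2 : σ₂ < 2) :
    ∫ r in Ioi 0, min (r ^ 2) 1 / (r * φ r) = lowerC φ 1 + upperC φ 1 := by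
  have hint := h.integrableOn_Ioi_min_sq_one_div h1 h2
  rw [← Ioc_union_Ioi_eq_Ioi (zero_le_one' ℝ)] at hint ⊢
  rw [setIntegral_union (Ioc_disjoint_Ioi le_rfl) measurableSet_Ioi hint.left_of_union
    hint.right_of_union, setIntegral_congr_fun measurableSet_Ioc eqOn_Ioc_min_sq_one_div,
    setIntegral_congr_fun measurableSet_Ioi eqOn_Ioi_min_sq_one_div, integral_Ioc_eq_integral_Ioo,
    lowerC, upperC]

theorem pow_pred_smul_div_pow_mul (n : ℕ) [NeZero n] (b c : ℝ) {r : ℝ} (hr : 0 < r) :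
    r ^ (n - 1) • (b * (1 / (r ^ n * c))) = b / (r * c) := by
  obtain ⟨k, rfl⟩ := Nat.exists_eq_succ_of_ne_zero (NeZero.ne n)
  rw [Nat.succ_eq_add_one, Nat.add_sub_cancel, pow_succ, smul_eq_mul, mul_one_div, mul_assoc,
    ← mul_div_assoc, mul_div_mul_left _ _ (by positivity)]

theorem WeakScaling.integrable_min_mul_radialKernel (h : WeakScaling φ a σ₁ σ₂) (h1 : 0 < σ₁)
    (h2 : σ₂ < 2) (n : ℕ) [NeZero n] :
    Integrable (fun y : E n => min (‖y‖ ^ 2) 1 * radialKernel n φ y) := by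
  refine (integrable_fun_norm_addHaar (volume : Measure (E n))
    (f := fun r => min (r ^ 2) 1 * (1 / (r ^ n * φ r)))).2 ?_
  rw [finrank_euclideanSpace_fin]
  refine (integrableOn_congr_fun (fun r hr => ?_) measurableSet_Ioi).2
    (h.integrableOn_Ioi_min_sq_one_div h1 h2)
  exact pow_pred_smul_div_pow_mul n _ _ hr

theorem WeakScaling.integral_min_mul_radialKernel (h : WeakScaling φ a σ₁ σ₂) (h1 : 0 < σ₁)
    (h2 : σ₂ < 2) (n : ℕ) [NeZero n] :
    ∫ y : E n, min (‖y‖ ^ 2) 1 * radialKernel n φ y =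
      n * unitBallVolume n * (lowerC φ 1 + upperC φ 1) := by
  have hpolar := integral_fun_norm_addHaar (volume : Measure (E n))
    (fun r => min (r ^ 2) 1 * (1 / (r ^ n * φ r)))
  rw [finrank_euclideanSpace_fin, setIntegral_congr_fun measurableSet_Ioi
    (fun r hr => pow_pred_smul_div_pow_mul n _ _ hr), h.setIntegral_Ioi_min_sq_one_div h1 h2,
    nsmul_eq_mul, smul_eq_mul, ← mul_assoc] at hpolar
  exact hpolar

theorem WeakScaling.integrable_mul_radialKernel (h : WeakScaling φ a σ₁ σ₂) (h1 : 0 < σ₁)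
    (h2 : σ₂ < 2) {n : ℕ} [NeZero n] {g : E n → ℝ} (hg : AEStronglyMeasurable g) {M : ℝ}
    (hgM : ∀ y, |g y| ≤ M * min (‖y‖ ^ 2) 1) :
    Integrable (fun y => g y * radialKernel n φ y) := by
  refine ((h.integrable_min_mul_radialKernel h1 h2 n).const_mul M).mono'
    (hg.mul (h.measurable_radialKernel n).aestronglyMeasurable) (.of_forall fun y => ?_)
  have hk := h.radialKernel_nonneg y
  rw [norm_mul, Real.norm_eq_abs, Real.norm_of_nonneg hk, ← mul_assoc]
  exact mul_le_mul_of_nonneg_right (hgM y) hk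

end RadialIntegral

section NormalizingConstant

variable {φ : ℝ → ℝ} {a σ₁ σ₂ : ℝ}

theorem one_sub_cos_le_two_mul_min (t : ℝ) : 1 - Real.cos t ≤ 2 * min (t ^ 2) 1 := by
  rw [mul_min_of_nonneg _ _ zero_le_two]
  refine le_min ?_ (by linarith [Real.neg_one_le_cos t])
  linarith [Real.one_sub_sq_div_two_le_cos (x := t), sq_nonneg t]

theorem abs_one_sub_cos_coord_le {n : ℕ} (y : E n) (i : Fin n) :
    |1 - Real.cos (y i)| ≤ 2 * min (‖y‖ ^ 2) 1 := by
  have hcoord : y i ^ 2 ≤ ‖y‖ ^ 2 := by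
    rw [← sq_abs, ← Real.norm_eq_abs]
    gcongr
    exact PiLp.norm_apply_le y i
  rw [abs_of_nonneg (by linarith [Real.cos_le_one (y i)])]
  exact (one_sub_cos_le_two_mul_min _).trans (by gcongr)

theorem normConst_eq_inv_integral (n : ℕ) [NeZero n] (φ : ℝ → ℝ) :
    normConst n φ = (∫ y : E n, (1 - Real.cos (y 0)) * radialKernel n φ y)⁻¹ := by
  simp only [normConst, radialKernel, mul_one_div]

theorem WeakScaling.integrable_one_sub_cos_mul_radialKernel (h : WeakScaling φ a σ₁ σ₂)
    (h1 : 0 < σ₁) (h2 : σ₂ < 2) (n : ℕ) [NeZero n] :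
    Integrable (fun y : E n => (1 - Real.cos (y 0)) * radialKernel n φ y) :=
  h.integrable_mul_radialKernel h1 h2
    (by fun_prop : Continuous fun y : E n => 1 - Real.cos (y 0)).aestronglyMeasurable
    fun y => abs_one_sub_cos_coord_le y 0

theorem WeakScaling.normConst_pos (h : WeakScaling φ a σ₁ σ₂) (h1 : 0 < σ₁) (h2 : σ₂ < 2)
    (n : ℕ) [NeZero n] : 0 < normConst n φ := by
  have hnonneg (y : E n) : 0 ≤ (1 - Real.cos (y 0)) * radialKernel n φ y :=
    mul_nonneg (by linarith [Real.cos_le_one (y 0)]) (h.radialKernel_nonneg y)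
  rw [normConst_eq_inv_integral, inv_pos, integral_pos_iff_support_of_nonneg hnonneg
    (h.integrable_one_sub_cos_mul_radialKernel h1 h2 n)]
  have hopen : IsOpen {y : E n | Real.cos (y 0) < 1} := isOpen_lt (by fun_prop) continuous_const
  refine (hopen.measure_pos volume ⟨EuclideanSpace.single 0 Real.pi, by simp⟩).trans_le
    (measure_mono fun y (hy : Real.cos (y 0) < 1) => ?_)
  have hy0 : y ≠ 0 := by
    rintro rfl
    simp at hy
  exact (mul_pos (sub_pos.2 hy) (h.radialKernel_pos hy0)).ne'

theorem WeakScaling.inv_normConst_le (h : WeakScaling φ a σ₁ σ₂) (h1 : 0 < σ₁) (h2 : σ₂ < 2)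
    (n : ℕ) [NeZero n] :
    (normConst n φ)⁻¹ ≤ 2 * (n * unitBallVolume n * (lowerC φ 1 + upperC φ 1)) := by
  rw [normConst_eq_inv_integral, inv_inv, ← h.integral_min_mul_radialKernel h1 h2 n,
    ← integral_const_mul]
  refine integral_mono (h.integrable_one_sub_cos_mul_radialKernel h1 h2 n)
    ((h.integrable_min_mul_radialKernel h1 h2 n).const_mul 2) fun y => ?_
  rw [← mul_assoc]
  exact mul_le_mul_of_nonneg_right ((le_abs_self _).trans (abs_one_sub_cos_coord_le y 0))
    (h.radialKernel_nonneg y)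

end NormalizingConstant

theorem norm_le_div_of_forall_inner_le {F : Type*} [NormedAddCommGroup F] [InnerProductSpace ℝ F]
    {q : F} {δ N : ℝ} (hδ : 0 < δ) (h : ∀ d : F, ‖d‖ ≤ δ → inner ℝ q d ≤ N) : ‖q‖ ≤ N / δ := by
  rw [le_div_iff₀ hδ]
  obtain rfl | hq := eq_or_ne q 0
  · simpa using h 0 (by simpa using hδ.le)
  have hq' := norm_ne_zero_iff.2 hq
  have hd := h ((δ / ‖q‖) • q) (by
    rw [norm_smul, Real.norm_of_nonneg (by positivity), div_mul_cancel₀ _ hq'])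
  rwa [real_inner_smul_right, real_inner_self_eq_norm_sq, sq, ← mul_assoc, div_mul_cancel₀ _ hq',
    mul_comm] at hd

section Envelope

variable {n : ℕ} {u : E n → ℝ} {R : ℝ}

/-- The affine functions lying above `u⁺` in `B_{3R}`; the pair `(p, t)` stands for the function
`y ↦ t + p · (y - x)` with slope `p` and value `t` at `x`. -/
def planesAbove (u : E n → ℝ) (R : ℝ) (x : E n) : Set (E n × ℝ) :=
  {q | ∀ y ∈ ball (0 : E n) (3 * R), max (u y) 0 ≤ q.2 + inner ℝ q.1 (y - x)}

theorem concaveEnvelope_eq_sInf {x : E n} (hx : x ∈ ball (0 : E n) (3 * R)) :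
    concaveEnvelope u R x = sInf (Prod.snd '' planesAbove u R x) := by
  rw [concaveEnvelope, if_pos hx]
  congr 1
  ext t
  simp only [mem_ofPred_eq, mem_image, Prod.exists, exists_eq_right, planesAbove, inner_sub_right]
  constructor
  · rintro ⟨p, c, hpc, rfl⟩
    exact ⟨p, fun y hy => (hpc y hy).trans_eq (by ring)⟩
  · rintro ⟨p, hp⟩
    exact ⟨p, t - inner ℝ p x, fun y hy => (hp y hy).trans_eq (by ring), by ring⟩

theorem nonneg_of_mem_planesAbove {x : E n} (hx : x ∈ ball (0 : E n) (3 * R)) {q : E n × ℝ}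
    (hq : q ∈ planesAbove u R x) : 0 ≤ q.2 := by
  simpa using (le_max_right _ _).trans (hq x hx)

theorem concaveEnvelope_le {p x : E n} {t : ℝ}
    (h : ∀ y ∈ ball (0 : E n) (3 * R), max (u y) 0 ≤ t + inner ℝ p (y - x)) {y : E n}
    (hy : y ∈ ball (0 : E n) (3 * R)) : concaveEnvelope u R y ≤ t + inner ℝ p (y - x) := by
  rw [concaveEnvelope_eq_sInf hy]
  refine csInf_le ⟨0, ?_⟩ ⟨(p, t + inner ℝ p (y - x)), fun z hz => (h z hz).trans_eq ?_, rfl⟩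
  · rintro _ ⟨q, hq, rfl⟩
    exact nonneg_of_mem_planesAbove hy hq
  · rw [add_assoc, ← inner_add_right, add_comm (y - x), sub_add_sub_cancel]

/-- Planes with bounded value at `x` have bounded slope, because they are nonnegative near `x`. -/
theorem isCompact_planesAbove_inter {x : E n} (hx : x ∈ ball (0 : E n) (3 * R)) (B : ℝ) :
    IsCompact (planesAbove u R x ∩ {q | q.2 ≤ B}) := by
  have hclosed : IsClosed (planesAbove u R x) := by
    simp only [planesAbove, ofPred_forall]
    exact isClosed_biInter fun y _ => isClosed_le continuous_const (by fun_prop)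
  obtain ⟨δ, hδ, hball⟩ := nhds_basis_closedBall.mem_iff.1 (isOpen_ball.mem_nhds hx)
  refine ((isCompact_closedBall (0 : E n) (B / δ)).prod (isCompact_Icc (a := 0) (b := B)))
    |>.of_isClosed_subset (hclosed.inter (isClosed_le continuous_snd continuous_const)) ?_
  rintro ⟨p, t⟩ ⟨hq, htB : t ≤ B⟩
  refine ⟨mem_closedBall_zero_iff.2 (norm_le_div_of_forall_inner_le hδ fun d hd => ?_),
    nonneg_of_mem_planesAbove hx hq, htB⟩
  have hnonneg := (le_max_right _ _).trans (hq (x - d) (hball (by simpa using hd)))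
  simp only [sub_sub_cancel_left, inner_neg_right] at hnonneg
  linarith

theorem exists_supporting_plane (hB : BddAbove (range u)) {x : E n}
    (hx : x ∈ ball (0 : E n) (3 * R)) :
    ∃ p : E n, ∀ y ∈ ball (0 : E n) (3 * R),
      max (u y) 0 ≤ concaveEnvelope u R x + inner ℝ p (y - x) := by
  obtain ⟨B, hB⟩ := hB
  have hconst : ((0 : E n), max B 0) ∈ planesAbove u R x := fun y _ => by
    simpa using max_le_max_right 0 (hB (mem_range_self y))
  obtain ⟨⟨p, t⟩, ⟨hpt, htB⟩, hmin⟩ := (isCompact_planesAbove_inter hx (max B 0)).exists_isMinOn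
    ⟨_, hconst, le_refl (max B 0)⟩ continuous_snd.continuousOn
  have hleast : IsLeast (Prod.snd '' planesAbove u R x) t := by
    refine ⟨⟨_, hpt, rfl⟩, ?_⟩
    rintro _ ⟨q, hq, rfl⟩
    rcases le_or_gt q.2 (max B 0) with hqB | hqB
    · exact hmin ⟨hq, hqB⟩
    · exact htB.trans hqB.le
  rw [concaveEnvelope_eq_sInf hx, hleast.csInf_eq]
  exact ⟨p, hpt⟩

theorem max_le_concaveEnvelope (hB : BddAbove (range u)) {x : E n}
    (hx : x ∈ ball (0 : E n) (3 * R)) : max (u x) 0 ≤ concaveEnvelope u R x := by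
  obtain ⟨p, hp⟩ := exists_supporting_plane hB hx
  simpa using hp x hx

theorem concaveOn_concaveEnvelope (hB : BddAbove (range u)) :
    ConcaveOn ℝ (ball (0 : E n) (3 * R)) (concaveEnvelope u R) := by
  refine ⟨convex_ball _ _, fun y hy z hz α β hα hβ hαβ => ?_⟩
  obtain ⟨p, hp⟩ := exists_supporting_plane hB (convex_ball _ _ hy hz hα hβ hαβ)
  set w := α • y + β • z with hw
  have hbary : α * inner ℝ p (y - w) + β * inner ℝ p (z - w) = 0 := by
    rw [← inner_smul_right, ← inner_smul_right, ← inner_add_right, smul_sub, smul_sub,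
      sub_add_sub_comm, ← hw, ← add_smul, hαβ, one_smul, sub_self, inner_zero_right]
  calc α * concaveEnvelope u R y + β * concaveEnvelope u R z
      ≤ α * (concaveEnvelope u R w + inner ℝ p (y - w))
        + β * (concaveEnvelope u R w + inner ℝ p (z - w)) := by
        gcongr
        · exact concaveEnvelope_le hp hy
        · exact concaveEnvelope_le hp hz
    _ = (α + β) * concaveEnvelope u R w
        + (α * inner ℝ p (y - w) + β * inner ℝ p (z - w)) := by ring
    _ = concaveEnvelope u R w := by rw [hbary, hαβ, one_mul, add_zero]

theorem concaveEnvelope_pos (hB : BddAbove (range u))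
    (hout : ∀ x, x ∉ ball (0 : E n) R → u x ≤ 0) (hpos : ∃ x, 0 < u x) {z : E n} (hz : ‖z‖ ≤ R) :
    0 < concaveEnvelope u R z := by
  obtain ⟨x, hx⟩ := hpos
  have hxR : ‖x‖ < R := by
    by_contra hxR
    exact (hout x (by simpa using hxR)).not_gt hx
  -- `z` lies between `x` and a point of `B_{3R}`, where the envelope is nonnegative
  set w := z + (1 / 2 : ℝ) • (z - x) with hw
  have hx3 : x ∈ ball (0 : E n) (3 * R) := mem_ball_zero_iff.2 (by linarith [norm_nonneg x])
  have hw3 : w ∈ ball (0 : E n) (3 * R) := mem_ball_zero_iff.2 <| calc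
    ‖w‖ ≤ ‖z‖ + 1 / 2 * (‖z‖ + ‖x‖) := by
      refine (norm_add_le _ _).trans ?_
      rw [norm_smul, Real.norm_of_nonneg (by norm_num)]
      gcongr
      exact norm_sub_le _ _
    _ < 3 * R := by linarith [norm_nonneg x]
  have hzw : (1 / 3 : ℝ) • x + (2 / 3 : ℝ) • w = z := by
    rw [hw]
    module
  have hconc := (concaveOn_concaveEnvelope hB).2 hx3 hw3 (by norm_num : (0 : ℝ) ≤ 1 / 3)
    (by norm_num : (0 : ℝ) ≤ 2 / 3) (by norm_num)
  rw [hzw, smul_eq_mul, smul_eq_mul] at hconc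
  have hΓx := (le_max_left _ _).trans (max_le_concaveEnvelope hB hx3)
  have hΓw := (le_max_right _ _).trans (max_le_concaveEnvelope hB hw3)
  linarith

theorem contactSet_pos (hB : BddAbove (range u)) (hout : ∀ x, x ∉ ball (0 : E n) R → u x ≤ 0)
    (hpos : ∃ x, 0 < u x) {x : E n} (hx : x ∈ contactSet u R) : 0 < u x := by
  rw [hx.2]
  exact concaveEnvelope_pos hB hout hpos (mem_ball_zero_iff.1 hx.1).le

theorem isCompact_contactSet (hB : BddAbove (range u)) (hR : 0 < R)
    (husc : UpperSemicontinuousOn u (closure (ball (0 : E n) R)))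
    (hout : ∀ x, x ∉ ball (0 : E n) R → u x ≤ 0) (hpos : ∃ x, 0 < u x) :
    IsCompact (contactSet u R) := by
  rw [closure_ball _ hR.ne'] at husc
  have hsub : closedBall (0 : E n) R ⊆ ball 0 (3 * R) := closedBall_subset_ball (by linarith)
  have hcont : ContinuousOn (fun x => -concaveEnvelope u R x) (closedBall (0 : E n) R) :=
    (((concaveOn_concaveEnvelope hB).continuousOn isOpen_ball).mono hsub).neg
  convert (husc.add hcont.upperSemicontinuousOn).isCompact_inter_preimage_Ici
    (isCompact_closedBall _ _) 0 using 1
  ext x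
  simp only [contactSet, mem_ofPred_eq, mem_inter_iff, mem_preimage, mem_Ici]
  constructor
  · rintro ⟨hxR, heq⟩
    exact ⟨ball_subset_closedBall hxR, by linarith⟩
  · rintro ⟨hxR, hge⟩
    have hΓpos := concaveEnvelope_pos hB hout hpos (mem_closedBall_zero_iff.1 hxR)
    refine ⟨?_, le_antisymm ((le_max_left _ _).trans (max_le_concaveEnvelope hB (hsub hxR)))
      (by linarith)⟩
    by_contra hxball
    linarith [hout x hxball]

end Envelope

section SecondDifference

variable {n : ℕ} {u : E n → ℝ} {R : ℝ}

theorem aemeasurable_secondDiff (hu : AEMeasurable u) (x : E n) :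
    AEMeasurable (secondDiff u x) :=
  ((hu.comp_quasiMeasurePreserving
      (measurePreserving_add_left volume x).quasiMeasurePreserving).add
    (hu.comp_quasiMeasurePreserving
      (Measure.measurePreserving_sub_left volume x).quasiMeasurePreserving)).sub_const _

theorem abs_secondDiff_le {B : ℝ} (hB : ∀ x, |u x| ≤ B) (x y : E n) :
    |secondDiff u x y| ≤ 4 * B := by
  have hadd := abs_le.1 (hB (x + y))
  have hsub := abs_le.1 (hB (x - y))
  have hx := abs_le.1 (hB x)
  rw [secondDiff, abs_le]
  constructor <;> linarith

theorem add_notMem_ball_zero {F : Type*} [SeminormedAddCommGroup F] {R : ℝ} {x y : F}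
    (hx : ‖x‖ < R) (hy : 2 * R ≤ ‖y‖) : x + y ∉ ball 0 R := by
  rw [mem_ball_zero_iff, not_lt]
  linarith [norm_le_add_norm_add' x y]

theorem secondDiff_le_of_two_mul_le_norm (hout : ∀ x, x ∉ ball (0 : E n) R → u x ≤ 0)
    {x y : E n} (hx : x ∈ ball (0 : E n) R) (hy : 2 * R ≤ ‖y‖) :
    secondDiff u x y ≤ -2 * u x := by
  have hx := mem_ball_zero_iff.1 hx
  have hadd := hout (x + y) (add_notMem_ball_zero hx hy)
  have hsub := hout (x - y) (sub_eq_add_neg x y ▸ add_notMem_ball_zero hx (by rwa [norm_neg]))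
  rw [secondDiff]
  linarith

theorem secondDiff_nonpos (hout : ∀ x, x ∉ ball (0 : E n) R → u x ≤ 0)
    {x p : E n} (hx : x ∈ ball (0 : E n) R) (hux : 0 ≤ u x)
    (hp : ∀ y ∈ ball (0 : E n) (3 * R), u y ≤ u x + inner ℝ p (y - x)) (y : E n) :
    secondDiff u x y ≤ 0 := by
  rcases le_or_gt (2 * R) ‖y‖ with hy | hy
  · exact (secondDiff_le_of_two_mul_le_norm hout hx hy).trans (by linarith)
  · have hx := mem_ball_zero_iff.1 hx
    have hadd := hp (x + y) (mem_ball_zero_iff.2 (by linarith [norm_add_le x y]))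
    have hsub := hp (x - y) (mem_ball_zero_iff.2 (by linarith [norm_sub_le x y]))
    rw [add_sub_cancel_left] at hadd
    rw [sub_sub_cancel_left, inner_neg_right] at hsub
    rw [secondDiff]
    linarith

end SecondDifference

section MaximalOperator

variable {n : ℕ} [NeZero n] {φ : ℝ → ℝ} {a σ₁ σ₂ lam Lam : ℝ}

theorem div_one_add_le_min {t : ℝ} (ht : 0 ≤ t) : t / (1 + t) ≤ min t 1 :=
  le_min (div_le_self ht (by linarith)) ((div_le_one (by linarith)).2 (by linarith))

theorem min_le_two_mul_div_one_add {t : ℝ} (ht : 0 ≤ t) : min t 1 ≤ 2 * (t / (1 + t)) := by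
  rw [← mul_div_assoc, le_div_iff₀ (by linarith), mul_add, mul_one, two_mul]
  refine add_le_add (min_le_left _ _) ?_
  calc min t 1 * t ≤ 1 * t := by gcongr; exact min_le_right _ _
    _ = t := one_mul t

theorem WeakScaling.isKernel_radialKernel (h : WeakScaling φ a σ₁ σ₂) (h1 : 0 < σ₁) (h2 : σ₂ < 2)
    (hl : lam ≤ Lam) :
    IsKernel φ lam Lam (fun y : E n => normConst n φ * (lam * radialKernel n φ y)) where
  measurable := ((h.measurable_radialKernel n).const_mul _).const_mul _
  symm y := by simp only [radialKernel, norm_neg]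
  integrable := by
    have hint := (h.integrable_mul_radialKernel h1 h2 (M := 1)
      (g := fun y : E n => ‖y‖ ^ 2 / (1 + ‖y‖ ^ 2))
      (by fun_prop : Measurable _).aestronglyMeasurable fun y => by
        rw [one_mul, abs_of_nonneg (by positivity)]
        exact div_one_add_le_min (sq_nonneg _)).const_mul (normConst n φ * lam)
    exact hint.congr (.of_forall fun y => by ring)
  lower y _ := by rw [radialKernel, mul_one_div]
  upper y _ := by
    have hC := (h.normConst_pos h1 h2 n).le
    rw [← mul_one_div Lam]
    exact mul_le_mul_of_nonneg_left (mul_le_mul_of_nonneg_right hl (h.radialKernel_nonneg y)) hC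

theorem IsKernel.integrable_mul {K : E n → ℝ} (hK : IsKernel φ lam Lam K) {g : E n → ℝ}
    (hg : AEStronglyMeasurable g) {M : ℝ} (hgM : ∀ y, |g y| ≤ M * min (‖y‖ ^ 2) 1) :
    Integrable (fun y => g y * K y) := by
  refine (hK.integrable.const_mul (|M| * 2)).mono
    (hg.mul hK.measurable.aestronglyMeasurable) (.of_forall fun y => ?_)
  rw [← mul_assoc, norm_mul, norm_mul _ (K y)]
  gcongr
  calc ‖g y‖ ≤ M * min (‖y‖ ^ 2) 1 := hgM y
    _ ≤ |M| * (2 * (‖y‖ ^ 2 / (1 + ‖y‖ ^ 2))) := by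
      gcongr
      · exact le_abs_self M
      · exact min_le_two_mul_div_one_add (sq_nonneg _)
    _ ≤ ‖|M| * 2 * (‖y‖ ^ 2 / (1 + ‖y‖ ^ 2))‖ := by
      rw [← mul_assoc]
      exact le_abs_self _

theorem IsKernel.mul_le {K : E n → ℝ} (hK : IsKernel φ lam Lam K) {y : E n} (hy : y ≠ 0) (t : ℝ) :
    t * K y ≤ normConst n φ * ((Lam * max t 0 - lam * max (-t) 0) * radialKernel n φ y) := by
  have hlow := hK.lower y hy
  have hupp := hK.upper y hy
  rw [← mul_one_div, ← radialKernel] at hlow hupp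
  calc t * K y = max t 0 * K y - max (-t) 0 * K y := by
        rw [← sub_mul, max_zero_sub_max_neg_zero_eq_self]
    _ ≤ max t 0 * (normConst n φ * (Lam * radialKernel n φ y))
        - max (-t) 0 * (normConst n φ * (lam * radialKernel n φ y)) := by gcongr
    _ = _ := by ring

theorem WeakScaling.maxOp_le (h : WeakScaling φ a σ₁ σ₂) (h1 : 0 < σ₁) (h2 : σ₂ < 2)
    (hl : lam ≤ Lam) {v : E n → ℝ} {x : E n} (hv : AEMeasurable (secondDiff v x)) {M : ℝ}
    (hM : ∀ y, |secondDiff v x y| ≤ M * min (‖y‖ ^ 2) 1) :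
    maxOp φ lam Lam v x ≤ normConst n φ *
      ∫ y, (Lam * max (secondDiff v x y) 0 - lam * max (-secondDiff v x y) 0)
        * radialKernel n φ y := by
  refine csSup_le ⟨_, _, h.isKernel_radialKernel h1 h2 hl, rfl⟩ ?_
  rintro _ ⟨K, hK, rfl⟩
  have hbound (y : E n) : |Lam * max (secondDiff v x y) 0 - lam * max (-secondDiff v x y) 0| ≤
      (|Lam| + |lam|) * M * min (‖y‖ ^ 2) 1 := by
    have hpos : |max (secondDiff v x y) 0| ≤ |secondDiff v x y| := by
      rw [abs_of_nonneg (le_max_right _ _)]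
      exact max_le (le_abs_self _) (abs_nonneg _)
    have hneg : |max (-secondDiff v x y) 0| ≤ |secondDiff v x y| := by
      rw [abs_of_nonneg (le_max_right _ _)]
      exact max_le (neg_le_abs _) (abs_nonneg _)
    calc |Lam * max (secondDiff v x y) 0 - lam * max (-secondDiff v x y) 0|
        ≤ |Lam| * |max (secondDiff v x y) 0| + |lam| * |max (-secondDiff v x y) 0| := by
          rw [← abs_mul, ← abs_mul]
          exact abs_sub _ _
      _ ≤ |Lam| * |secondDiff v x y| + |lam| * |secondDiff v x y| := by gcongr
      _ = (|Lam| + |lam|) * |secondDiff v x y| := by ring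
      _ ≤ (|Lam| + |lam|) * (M * min (‖y‖ ^ 2) 1) := by gcongr; exact hM y
      _ = _ := by ring
  have hmeas : AEMeasurable
      (fun y => Lam * max (secondDiff v x y) 0 - lam * max (-secondDiff v x y) 0) :=
    ((hv.max aemeasurable_const).const_mul _).sub ((hv.neg.max aemeasurable_const).const_mul _)
  rw [linOp, ← integral_const_mul]
  refine integral_mono_ae (hK.integrable_mul hv.aestronglyMeasurable hM)
    ((h.integrable_mul_radialKernel h1 h2 hmeas.aestronglyMeasurable hbound).const_mul _) ?_
  filter_upwards [Measure.ae_ne volume 0] with y hy using hK.mul_le hy _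

end MaximalOperator

section TestFunction

variable {n : ℕ} {u : E n → ℝ}

open Classical in
/-- The competitor in the definition of viscosity subsolutions: a paraboloid of opening `ε` and
slope `p` touching `u` at `x`, glued to `u` outside `B_ρ(x)`. -/
noncomputable def testFunction (u : E n → ℝ) (x p : E n) (ε ρ : ℝ) : E n → ℝ :=
  (ball x ρ).piecewise (fun y => u x + inner ℝ p (y - x) + ε * ‖y - x‖ ^ 2) u

open Classical in
theorem secondDiff_testFunction (u : E n → ℝ) (x p : E n) (ε : ℝ) {ρ : ℝ} (hρ : 0 < ρ) :
    secondDiff (testFunction u x p ε ρ) x =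
      (ball 0 ρ).piecewise (fun y => 2 * ε * ‖y‖ ^ 2) (secondDiff u x) := by
  ext y
  have hx : testFunction u x p ε ρ x = u x := by
    simp [testFunction, piecewise_eq_of_mem _ _ _ (mem_ball_self hρ)]
  have hadd : x + y ∈ ball x ρ ↔ y ∈ ball 0 ρ := by simp
  have hsub : x - y ∈ ball x ρ ↔ y ∈ ball 0 ρ := by simp
  rw [secondDiff, hx]
  by_cases hy : y ∈ ball 0 ρ
  · rw [testFunction, piecewise_eq_of_mem _ _ _ (hadd.2 hy), piecewise_eq_of_mem _ _ _ (hsub.2 hy),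
      piecewise_eq_of_mem _ _ _ hy, add_sub_cancel_left, sub_sub_cancel_left, inner_neg_right,
      norm_neg]
    ring
  · rw [testFunction, piecewise_eq_of_notMem _ _ _ (mt hadd.1 hy),
      piecewise_eq_of_notMem _ _ _ (mt hsub.1 hy), piecewise_eq_of_notMem _ _ _ hy, secondDiff]

theorem abs_secondDiff_testFunction_le {B : ℝ} (hB : ∀ x, |u x| ≤ B) (x p : E n) {ε ρ : ℝ}
    (hε : 0 ≤ ε) (hρ : 0 < ρ) (y : E n) :
    |secondDiff (testFunction u x p ε ρ) x y| ≤
      (2 * ε * (ρ ^ 2 + 1) + 4 * B / min (ρ ^ 2) 1) * min (‖y‖ ^ 2) 1 := by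
  classical
  have hB0 : 0 ≤ B := (abs_nonneg _).trans (hB 0)
  have hm : 0 < min (ρ ^ 2) 1 := lt_min (by positivity) one_pos
  have : 0 ≤ min (‖y‖ ^ 2) 1 := le_min (by positivity) zero_le_one
  rw [secondDiff_testFunction u x p ε hρ, add_mul]
  by_cases hy : y ∈ ball 0 ρ
  · have hyρ : ‖y‖ ^ 2 ≤ ρ ^ 2 := by
      gcongr
      exact (mem_ball_zero_iff.1 hy).le
    have hmin : ‖y‖ ^ 2 ≤ (ρ ^ 2 + 1) * min (‖y‖ ^ 2) 1 := by
      rw [mul_min_of_nonneg _ _ (by positivity), mul_one]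
      exact le_min (le_mul_of_one_le_left (by positivity) (by linarith [sq_nonneg ρ]))
        (by linarith)
    rw [piecewise_eq_of_mem _ _ _ hy, abs_of_nonneg (by positivity), mul_assoc (2 * ε)]
    exact le_add_of_le_of_nonneg (by gcongr) (by positivity)
  · have hyρ : min (ρ ^ 2) 1 ≤ min (‖y‖ ^ 2) 1 := by
      gcongr
      simpa using hy
    rw [piecewise_eq_of_notMem _ _ _ hy]
    refine le_add_of_nonneg_of_le (by positivity) ((abs_secondDiff_le hB x y).trans ?_)
    rw [div_mul_eq_mul_div, le_div_iff₀ hm]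
    gcongr

theorem aemeasurable_secondDiff_testFunction (hu : AEMeasurable u) (x p : E n) (ε : ℝ) {ρ : ℝ}
    (hρ : 0 < ρ) : AEMeasurable (secondDiff (testFunction u x p ε ρ) x) := by
  classical
  rw [secondDiff_testFunction u x p ε hρ, ← indicator_add_compl_eq_piecewise]
  exact ((by fun_prop : Measurable _).aemeasurable.indicator measurableSet_ball).add
    ((aemeasurable_secondDiff hu x).indicator measurableSet_ball.compl)

theorem IsViscositySubsolution.le_testFunction {I : (E n → ℝ) → E n → ℝ} {g : E n → ℝ}
    {Ω : Set (E n)} (hsub : IsViscositySubsolution I g Ω u) {x p : E n} {ε ρ : ℝ} (hε : 0 < ε)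
    (hρ : 0 < ρ) (hball : ball x ρ ⊆ Ω) (hp : ∀ y ∈ ball x ρ, u y ≤ u x + inner ℝ p (y - x)) :
    g x ≤ I (testFunction u x p ε ρ) x := by
  classical
  have hsmooth : ContDiff ℝ 2 fun y => u x + inner ℝ p (y - x) + ε * ‖y - x‖ ^ 2 := by
    have hid : ContDiff ℝ 2 fun y : E n => y - x := contDiff_id.sub contDiff_const
    exact (contDiff_const.add (contDiff_const.inner ℝ hid)).add
      (contDiff_const.mul (hid.norm_sq ℝ))
  refine hsub.test x (hball (mem_ball_self hρ)) (ball x ρ) isOpen_ball (mem_ball_self hρ)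
    isBounded_ball hball _ hsmooth (by simp) (fun y hy => ?_) _
    (fun y hy => piecewise_eq_of_mem _ _ _ hy) (fun y hy => piecewise_eq_of_notMem _ _ _ hy)
  have hne : 0 < ‖y - x‖ := norm_pos_iff.2 (sub_ne_zero.2 hy.2)
  exact (hp y hy.1).trans_lt (lt_add_of_pos_right _ (by positivity))

end TestFunction

section ContactPoint

variable {n : ℕ} [NeZero n] {u f : E n → ℝ} {φ : ℝ → ℝ} {a σ₁ σ₂ lam Lam R : ℝ} {x p : E n}

theorem WeakScaling.neg_le_of_testFunction (h : WeakScaling φ a σ₁ σ₂) (h1 : 0 < σ₁) (h2 : σ₂ < 2)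
    (hl : lam ≤ Lam)
    (hsub : IsViscositySubsolution (maxOp φ lam Lam) (fun x => -f x) (ball 0 R) u)
    (hδ : ∀ y, secondDiff u x y ≤ 0) {ε ρ : ℝ} (hε : 0 < ε) (hρ : 0 < ρ)
    (hball : ball x ρ ⊆ ball 0 R) (hp : ∀ y ∈ ball x ρ, u y ≤ u x + inner ℝ p (y - x)) :
    -f x ≤ normConst n φ * (Lam * (2 * ε * ∫ y in ball (0 : E n) ρ, ‖y‖ ^ 2 * radialKernel n φ y) +
      lam * ∫ y in (ball (0 : E n) ρ)ᶜ, secondDiff u x y * radialKernel n φ y) := by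
  classical
  obtain ⟨B, hB⟩ := hsub.bounded
  have hmeas := aemeasurable_secondDiff_testFunction hsub.aemeasurable x p ε hρ
  have hbound := abs_secondDiff_testFunction_le hB x p hε.le hρ
  have hsd := secondDiff_testFunction u x p ε hρ
  have hint := h.integrable_mul_radialKernel h1 h2 hmeas.aestronglyMeasurable hbound
  have hin : IntegrableOn (fun y => 2 * ε * (‖y‖ ^ 2 * radialKernel n φ y)) (ball 0 ρ) :=
    hint.integrableOn.congr_fun (fun y hy => by
      simp only [hsd, piecewise_eq_of_mem _ _ _ hy, mul_assoc]) measurableSet_ball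
  have hout : IntegrableOn (fun y => secondDiff u x y * radialKernel n φ y) (ball 0 ρ)ᶜ :=
    hint.integrableOn.congr_fun (fun y hy => by
      simp only [hsd, piecewise_eq_of_notMem _ _ _ hy]) measurableSet_ball.compl
  calc -f x ≤ maxOp φ lam Lam (testFunction u x p ε ρ) x := hsub.le_testFunction hε hρ hball hp
    _ ≤ _ := h.maxOp_le h1 h2 hl hmeas hbound
    _ = normConst n φ * ∫ y, (ball 0 ρ).piecewise
          (fun y => Lam * (2 * ε * (‖y‖ ^ 2 * radialKernel n φ y)))
          (fun y => lam * (secondDiff u x y * radialKernel n φ y)) y := by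
      congr with y
      rw [hsd]
      by_cases hy : y ∈ ball 0 ρ
      · simp only [piecewise_eq_of_mem _ _ _ hy]
        rw [max_eq_left (by positivity), max_eq_right (neg_nonpos.2 (by positivity))]
        ring
      · simp only [piecewise_eq_of_notMem _ _ _ hy]
        rw [max_eq_right (hδ y), max_eq_left (neg_nonneg.2 (hδ y))]
        ring
    _ = _ := by
      rw [integral_piecewise measurableSet_ball (hin.const_mul _) (hout.const_mul _)]
      simp only [integral_const_mul]

theorem WeakScaling.integrableOn_secondDiff_mul_radialKernel (h : WeakScaling φ a σ₁ σ₂)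
    (h1 : 0 < σ₁) (h2 : σ₂ < 2) (hu : AEMeasurable u) {B : ℝ} (hB : ∀ x, |u x| ≤ B) (x : E n)
    {ρ : ℝ} (hρ : 0 < ρ) :
    IntegrableOn (fun y => secondDiff u x y * radialKernel n φ y) (ball 0 ρ)ᶜ := by
  classical
  have hint := h.integrable_mul_radialKernel h1 h2
    (aemeasurable_secondDiff_testFunction hu x 0 0 hρ).aestronglyMeasurable
    (abs_secondDiff_testFunction_le hB x 0 le_rfl hρ)
  refine hint.integrableOn.congr_fun (fun y hy => ?_) measurableSet_ball.compl
  simp only [secondDiff_testFunction u x 0 0 hρ, piecewise_eq_of_notMem _ _ _ hy]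

theorem WeakScaling.mul_setIntegral_neg_secondDiff_le (h : WeakScaling φ a σ₁ σ₂) (h1 : 0 < σ₁)
    (h2 : σ₂ < 2) (hl : lam ≤ Lam)
    (hsub : IsViscositySubsolution (maxOp φ lam Lam) (fun x => -f x) (ball 0 R) u)
    (hδ : ∀ y, secondDiff u x y ≤ 0) {ρ : ℝ} (hρ : 0 < ρ) (hball : ball x ρ ⊆ ball 0 R)
    (hp : ∀ y ∈ ball x ρ, u y ≤ u x + inner ℝ p (y - x)) :
    lam * normConst n φ * ∫ y in (ball (0 : E n) ρ)ᶜ, -secondDiff u x y * radialKernel n φ y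
      ≤ f x := by
  set A := ∫ y in ball (0 : E n) ρ, ‖y‖ ^ 2 * radialKernel n φ y
  set D := ∫ y in (ball (0 : E n) ρ)ᶜ, secondDiff u x y * radialKernel n φ y with hD
  have hlim : Tendsto (fun ε => normConst n φ * (Lam * (2 * ε * A) + lam * D)) (𝓝[>] 0)
      (𝓝 (normConst n φ * (Lam * (2 * 0 * A) + lam * D))) :=
    (Continuous.tendsto (by fun_prop) 0).mono_left nhdsWithin_le_nhds
  have hle := ge_of_tendsto hlim (eventually_mem_nhdsWithin.mono fun ε hε =>
    h.neg_le_of_testFunction h1 h2 hl hsub hδ hε hρ hball hp)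
  simp only [neg_mul, integral_neg, ← hD]
  linarith

theorem aecover_compl_ball_zero {ι : Type*} {l : Filter ι} {ρ : ι → ℝ}
    (hρ : Tendsto ρ l (𝓝 0)) : AECover (volume : Measure (E n)) l (fun i => (ball 0 (ρ i))ᶜ) where
  ae_eventually_mem := by
    filter_upwards [Measure.ae_ne volume 0] with y hy
    filter_upwards [hρ.eventually_lt_const (norm_pos_iff.2 hy)] with i hi
    simpa using hi.le
  measurableSet _ := measurableSet_ball.compl

/-- At a point touched from above by a plane the inequality `𝓜⁺u ≥ -f` holds classically. -/
theorem WeakScaling.integrable_secondDiff_and_mul_integral_le (h : WeakScaling φ a σ₁ σ₂)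
    (h1 : 0 < σ₁) (h2 : σ₂ < 2) (hlam : 0 < lam) (hl : lam ≤ Lam)
    (hsub : IsViscositySubsolution (maxOp φ lam Lam) (fun x => -f x) (ball 0 R) u)
    (hx : x ∈ ball 0 R) (hδ : ∀ y, secondDiff u x y ≤ 0)
    (hp : ∀ y ∈ ball 0 R, u y ≤ u x + inner ℝ p (y - x)) :
    Integrable (fun y => -secondDiff u x y * radialKernel n φ y) ∧
      lam * normConst n φ * ∫ y, -secondDiff u x y * radialKernel n φ y ≤ f x := by
  obtain ⟨B, hB⟩ := hsub.bounded
  obtain ⟨r, hr, hball⟩ := isOpen_iff.1 isOpen_ball x hx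
  obtain ⟨ρ, -, hρ, hρ0⟩ := exists_seq_strictAnti_tendsto' hr
  have hc : 0 < lam * normConst n φ := mul_pos hlam (h.normConst_pos h1 h2 n)
  have hsubset (i : ℕ) : ball x (ρ i) ⊆ ball 0 R :=
    (ball_subset_ball (hρ i).2.le).trans hball
  have hle (i : ℕ) : ∫ y in (ball (0 : E n) (ρ i))ᶜ, -secondDiff u x y * radialKernel n φ y ≤
      f x / (lam * normConst n φ) := by
    rw [le_div_iff₀' hc]
    exact h.mul_setIntegral_neg_secondDiff_le h1 h2 hl hsub hδ (hρ i).1 (hsubset i)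
      fun y hy => hp y (hsubset i hy)
  have hcover := aecover_compl_ball_zero (n := n) hρ0
  have hint : Integrable (fun y => -secondDiff u x y * radialKernel n φ y) := by
    refine hcover.integrable_of_integral_bounded_of_nonneg_ae _ (fun i => ?_)
      (.of_forall fun y => mul_nonneg (neg_nonneg.2 (hδ y)) (h.radialKernel_nonneg y))
      (.of_forall hle)
    simpa only [neg_mul] using! (h.integrableOn_secondDiff_mul_radialKernel h1 h2
      hsub.aemeasurable hB x (hρ i).1).neg
  exact ⟨hint, (le_div_iff₀' hc).1
    (le_of_tendsto' (hcover.integral_tendsto_of_countably_generated hint) hle)⟩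

theorem WeakScaling.integral_neg_secondDiff_pos (h : WeakScaling φ a σ₁ σ₂)
    (hint : Integrable (fun y => -secondDiff u x y * radialKernel n φ y))
    (hout : ∀ x, x ∉ ball (0 : E n) R → u x ≤ 0) (hx : x ∈ ball 0 R) (hux : 0 < u x)
    (hδ : ∀ y, secondDiff u x y ≤ 0) :
    0 < ∫ y, -secondDiff u x y * radialKernel n φ y := by
  have hR : 0 < R := pos_of_mem_ball hx
  rw [integral_pos_iff_support_of_nonneg
    (fun y => mul_nonneg (neg_nonneg.2 (hδ y)) (h.radialKernel_nonneg y)) hint]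
  have hopen : IsOpen {y : E n | 2 * R < ‖y‖} := isOpen_lt continuous_const continuous_norm
  refine (hopen.measure_pos volume ⟨EuclideanSpace.single 0 (3 * R), ?_⟩).trans_le
    (measure_mono fun y (hy : 2 * R < ‖y‖) => ?_)
  · rw [mem_ofPred_eq, PiLp.norm_single, Real.norm_of_nonneg (by positivity)]
    linarith
  · have hy0 : y ≠ 0 := norm_pos_iff.1 (by linarith)
    have hneg := secondDiff_le_of_two_mul_le_norm hout hx hy.le
    exact (mul_pos (by linarith) (h.radialKernel_pos hy0)).ne'

end ContactPoint

section DyadicDecomposition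

theorem pairwise_disjoint_Ioc_div_two_pow {T : ℝ} (hT : 0 ≤ T) :
    Pairwise (Disjoint on fun k : ℕ => Ioc (T / 2 ^ k / 2) (T / 2 ^ k)) := by
  have hanti : Antitone fun k : ℕ => T / 2 ^ k := fun i j hij => by
    dsimp only
    gcongr
    exact one_le_two
  simpa only [Order.succ_eq_add_one, pow_succ, ← div_div] using hanti.pairwise_disjoint_on_Ioc_succ

theorem iUnion_Ioc_div_two_pow {T : ℝ} (hT : 0 < T) :
    ⋃ k : ℕ, Ioc (T / 2 ^ k / 2) (T / 2 ^ k) = Ioc 0 T := by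
  refine Subset.antisymm (iUnion_subset fun k => Ioc_subset_Ioc (by positivity)
    (div_le_self hT.le (one_le_pow₀ one_le_two))) fun r hr => ?_
  obtain ⟨k, hlt, hle⟩ := exists_nat_pow_near_of_lt_one (div_pos hr.1 hT)
    ((div_le_one hT).2 hr.2) (one_half_pos (α := ℝ)) one_half_lt_one
  rw [one_div, inv_pow, ← one_div, lt_div_iff₀ hT, div_mul_eq_mul_div, one_mul] at hlt
  rw [one_div, inv_pow, ← one_div, div_le_iff₀ hT, div_mul_eq_mul_div, one_mul] at hle
  exact mem_iUnion.2 ⟨k, by rwa [div_div, ← pow_succ], hle⟩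

/-- The annulus `s / 2 < ‖y‖ ≤ s`. -/
def annulus (n : ℕ) (s : ℝ) : Set (E n) := norm ⁻¹' Ioc (s / 2) s

variable {n : ℕ} {s : ℝ}

theorem measurableSet_annulus (n : ℕ) (s : ℝ) : MeasurableSet (annulus n s) :=
  measurable_norm measurableSet_Ioc

theorem volume_annulus_lt_top (n : ℕ) (s : ℝ) : volume (annulus n s) < ⊤ :=
  (measure_mono fun _ hy => mem_closedBall_zero_iff.2 hy.2).trans_lt
    (measure_closedBall_lt_top (x := (0 : E n)) (r := s))

end DyadicDecomposition

section AnnulusEnergy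

variable {n : ℕ} [NeZero n] {φ : ℝ → ℝ} {a σ₁ σ₂ : ℝ}

theorem WeakScaling.integrableOn_Ioc_div (h : WeakScaling φ a σ₁ σ₂) (h2 : σ₂ < 2) (T : ℝ) :
    IntegrableOn (fun r => r / φ r) (Ioc 0 T) :=
  (integrableOn_Ioc_iff_integrableOn_Ioo).2 (h.integrableOn_Ioo_div h2 T)

theorem WeakScaling.setIntegral_Ioc_div_le (h : WeakScaling φ a σ₁ σ₂) (h2 : σ₂ < 2)
    {s : ℝ} (hs : 0 < s) : ∫ r in Ioc (s / 2) s, r / φ r ≤ 2 * a * s ^ 2 / φ s := by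
  have hφs := h.pos s hs
  have hint : IntegrableOn (fun r => r / φ r) (Ioc (s / 2) s) :=
    (h.integrableOn_Ioc_div h2 s).mono_set (Ioc_subset_Ioc_left (by positivity))
  calc ∫ r in Ioc (s / 2) s, r / φ r ≤ ∫ _ in Ioc (s / 2) s, 4 * a * s / φ s := by
        refine setIntegral_mono_on hint (integrableOn_const (by simp)) measurableSet_Ioc ?_
        intro r hr
        have hr0 : 0 < r := (half_pos hs).trans hr.1
        rw [div_le_div_iff₀ (h.pos r hr0) hφs]
        calc r * φ s ≤ s * (4 * a * φ r) :=
              mul_le_mul hr.2 (h.le_four_mul_of_le_two_mul h2.le hr0 hr.2 (by linarith [hr.1]))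
                hφs.le hs.le
          _ = 4 * a * s * φ r := by ring
    _ = 2 * a * s ^ 2 / φ s := by
        rw [setIntegral_const, Real.volume_real_Ioc_of_le (by linarith), smul_eq_mul]
        ring

theorem WeakScaling.le_radialKernel_of_mem_annulus (h : WeakScaling φ a σ₁ σ₂) {n : ℕ}
    (h1 : 0 ≤ σ₁) {s : ℝ} {y : E n} (hy : y ∈ annulus n s) :
    1 / (s ^ n * (a * φ s)) ≤ radialKernel n φ y := by
  have hy0 : 0 < ‖y‖ := by linarith [hy.1, hy.2]
  have := h.pos _ hy0
  have := hy0.trans_le hy.2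
  rw [radialKernel]
  gcongr
  · exact hy.2
  · exact h.le_mul_of_le h1 hy0 hy.2

theorem WeakScaling.mul_setIntegral_Ioc_le_setIntegral_annulus (h : WeakScaling φ a σ₁ σ₂)
    (h1 : 0 ≤ σ₁) (h2 : σ₂ < 2) {g : E n → ℝ} (hg : ∀ y, 0 ≤ g y) {s M β : ℝ} (hs : 0 < s)
    (hM : 0 ≤ M) (hβ : 0 ≤ β)
    (hint : IntegrableOn (fun y => g y * radialKernel n φ y) (annulus n s))
    (hvol : β * s ^ n ≤ volume.real {y ∈ annulus n s | M * s ^ 2 ≤ g y}) :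
    M * β / (2 * a ^ 2) * ∫ r in Ioc (s / 2) s, r / φ r ≤
      ∫ y in annulus n s, g y * radialKernel n φ y := by
  have hφs := h.pos s hs
  have ha : 0 < a := one_pos.trans_le h.one_le
  set ε := M * s ^ 2 * (1 / (s ^ n * (a * φ s))) with hε
  have hsubset : {y ∈ annulus n s | M * s ^ 2 ≤ g y} ⊆ {y | ε ≤ g y * radialKernel n φ y} :=
    fun y hy => mul_le_mul hy.2 (h.le_radialKernel_of_mem_annulus h1 hy.1) (by positivity) (hg y)
  calc M * β / (2 * a ^ 2) * ∫ r in Ioc (s / 2) s, r / φ r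
      ≤ M * β / (2 * a ^ 2) * (2 * a * s ^ 2 / φ s) := by
        gcongr
        exact h.setIntegral_Ioc_div_le h2 hs
    _ = ε * (β * s ^ n) := by
        rw [hε]
        field_simp
    _ ≤ ε * volume.real {y ∈ annulus n s | M * s ^ 2 ≤ g y} := by gcongr
    _ ≤ ε * (volume.restrict (annulus n s)).real {y | ε ≤ g y * radialKernel n φ y} := by
        gcongr
        rw [measureReal_def, ← Measure.restrict_eq_self _ (sep_subset (annulus n s) _)]
        exact measureReal_mono hsubset (measure_ne_top_of_subset (subset_univ _)
          (by simpa using (volume_annulus_lt_top n s).ne))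
    _ ≤ _ := mul_meas_ge_le_integral_of_nonneg
        (.of_forall fun y => mul_nonneg (hg y) (h.radialKernel_nonneg y)) hint ε

theorem WeakScaling.mul_lowerC_le_integral (h : WeakScaling φ a σ₁ σ₂) (h2 : σ₂ < 2) {n : ℕ}
    {G : E n → ℝ} (hG : ∀ y, 0 ≤ G y) (hint : Integrable G) {T c : ℝ} (hT : 0 < T)
    (hle : ∀ k : ℕ, c * ∫ r in Ioc (T / 2 ^ k / 2) (T / 2 ^ k), r / φ r ≤
      ∫ y in annulus n (T / 2 ^ k), G y) :
    c * lowerC φ T ≤ ∫ y, G y := by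
  have hdisj := pairwise_disjoint_Ioc_div_two_pow hT.le
  have hsumφ := hasSum_integral_iUnion (fun _ => measurableSet_Ioc) hdisj
    (by rw [iUnion_Ioc_div_two_pow hT]; exact h.integrableOn_Ioc_div h2 T)
  rw [iUnion_Ioc_div_two_pow hT, integral_Ioc_eq_integral_Ioo] at hsumφ
  have hsumG := hasSum_integral_iUnion (μ := volume) (f := G)
    (fun k => measurableSet_annulus n (T / 2 ^ k))
    (fun i j hij => (hdisj hij).preimage norm) hint.integrableOn
  exact (hasSum_le hle (hsumφ.mul_left c) hsumG).trans
    (setIntegral_le_integral hint (.of_forall hG))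

theorem WeakScaling.exists_volume_annulus_lt (h : WeakScaling φ a σ₁ σ₂) (h1 : 0 ≤ σ₁)
    (h2 : σ₂ < 2) {g : E n → ℝ} (hg : ∀ y, 0 ≤ g y)
    (hint : Integrable fun y => g y * radialKernel n φ y) {T M β : ℝ} (hT : 0 < T) (hM : 0 ≤ M)
    (hβ : 0 ≤ β)
    (hlt : ∫ y, g y * radialKernel n φ y < M * β / (2 * a ^ 2) * lowerC φ T) :
    ∃ k : ℕ, volume {y ∈ annulus n (T / 2 ^ k) | M * (T / 2 ^ k) ^ 2 ≤ g y} <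
      ENNReal.ofReal (β * (T / 2 ^ k) ^ n) := by
  contrapose! hlt
  refine h.mul_lowerC_le_integral h2 (fun y => mul_nonneg (hg y) (h.radialKernel_nonneg y)) hint hT
    fun k => h.mul_setIntegral_Ioc_le_setIntegral_annulus h1 h2 hg (by positivity) hM hβ
      hint.integrableOn ?_
  exact (ENNReal.ofReal_le_iff_le_toReal (measure_ne_top_of_subset (sep_subset _ _)
    (volume_annulus_lt_top n _).ne)).1 (hlt k)

end AnnulusEnergy

section GoodAnnulus

variable {n : ℕ} [NeZero n] {u f : E n → ℝ} {φ : ℝ → ℝ} {a σ₁ σ₂ lam Lam R T : ℝ} {x p : E n}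

/-- The constant in the quadratic detachment bound on a good annulus. -/
noncomputable def annulusConst (n : ℕ) (lam a : ℝ) : ℝ := 16 ^ (n + 1) * a ^ 2 * n / lam

theorem annulusConst_pos (n : ℕ) [NeZero n] (hlam : 0 < lam) (ha : 0 < a) :
    0 < annulusConst n lam a := by
  have : 0 < (n : ℝ) := Nat.cast_pos.2 (NeZero.pos n)
  unfold annulusConst
  positivity

theorem WeakScaling.integral_lt_annulusConst_mul (h : WeakScaling φ a σ₁ σ₂) (h1 : 0 < σ₁)
    (h2 : σ₂ < 2) (hlam : 0 < lam) (hT : 0 < T) {I F : ℝ} (hI : 0 < I)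
    (hIF : lam * normConst n φ * I ≤ F) :
    I < annulusConst n lam a * ((lowerC φ 1 + upperC φ 1) / lowerC φ T) * F *
      (unitBallVolume n / (2 * 16 ^ n)) / (2 * a ^ 2) * lowerC φ T := by
  have hC := h.normConst_pos h1 h2 n
  have ha : 0 < a := one_pos.trans_le h.one_le
  have hL := h.lowerC_pos h2 hT
  have hle : I ≤ (normConst n φ)⁻¹ * (F / lam) := by
    rw [inv_mul_eq_div, div_div, le_div_iff₀' (by positivity)]
    exact hIF
  have hF : 0 < F / lam := by
    have hpos : 0 < lam * normConst n φ * I := by positivity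
    exact div_pos (hpos.trans_le hIF) hlam
  have hCle := h.inv_normConst_le h1 h2 n
  calc I ≤ (normConst n φ)⁻¹ * (F / lam) := hle
    _ < (2 * (normConst n φ)⁻¹) * (F / lam) := by gcongr; linarith [inv_pos.2 hC]
    _ ≤ 2 * (2 * (n * unitBallVolume n * (lowerC φ 1 + upperC φ 1))) * (F / lam) := by gcongr
    _ = _ := by
      rw [annulusConst]
      field_simp
      ring

theorem WeakScaling.touching_point_integral (h : WeakScaling φ a σ₁ σ₂) (h1 : 0 < σ₁)
    (h2 : σ₂ < 2) (hlam : 0 < lam) (hl : lam ≤ Lam)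
    (hsub : IsViscositySubsolution (maxOp φ lam Lam) (fun x => -f x) (ball 0 R) u)
    (hout : ∀ x, x ∉ ball (0 : E n) R → u x ≤ 0) (hx : x ∈ ball (0 : E n) R) (hux : 0 < u x)
    (hp : ∀ y ∈ ball (0 : E n) (3 * R), u y ≤ u x + inner ℝ p (y - x)) :
    Integrable (fun y => -secondDiff u x y * radialKernel n φ y) ∧
      0 < ∫ y, -secondDiff u x y * radialKernel n φ y ∧
      lam * normConst n φ * ∫ y, -secondDiff u x y * radialKernel n φ y ≤ f x := by
  have hδ := secondDiff_nonpos hout hx hux.le hp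
  have hR : 0 < R := pos_of_mem_ball hx
  obtain ⟨hint, hle⟩ := h.integrable_secondDiff_and_mul_integral_le h1 h2 hlam hl hsub hx hδ
    fun y hy => hp y (ball_subset_ball (by linarith) hy)
  exact ⟨hint, h.integral_neg_secondDiff_pos hint hout hx hux hδ, hle⟩

theorem WeakScaling.pos_of_touching_point (h : WeakScaling φ a σ₁ σ₂) (h1 : 0 < σ₁) (h2 : σ₂ < 2)
    (hlam : 0 < lam) (hl : lam ≤ Lam)
    (hsub : IsViscositySubsolution (maxOp φ lam Lam) (fun x => -f x) (ball 0 R) u)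
    (hout : ∀ x, x ∉ ball (0 : E n) R → u x ≤ 0) (hx : x ∈ ball (0 : E n) R) (hux : 0 < u x)
    (hp : ∀ y ∈ ball (0 : E n) (3 * R), u y ≤ u x + inner ℝ p (y - x)) : 0 < f x := by
  obtain ⟨-, hpos, hle⟩ := h.touching_point_integral h1 h2 hlam hl hsub hout hx hux hp
  exact (mul_pos (mul_pos hlam (h.normConst_pos h1 h2 n)) hpos).trans_le hle

theorem WeakScaling.exists_good_annulus (h : WeakScaling φ a σ₁ σ₂) (h1 : 0 < σ₁) (h2 : σ₂ < 2)
    (hlam : 0 < lam) (hl : lam ≤ Lam)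
    (hsub : IsViscositySubsolution (maxOp φ lam Lam) (fun x => -f x) (ball 0 R) u)
    (hout : ∀ x, x ∉ ball (0 : E n) R → u x ≤ 0) (hx : x ∈ ball (0 : E n) R) (hux : 0 < u x)
    (hp : ∀ y ∈ ball (0 : E n) (3 * R), u y ≤ u x + inner ℝ p (y - x))
    (hT : 0 < T) (hTR : T ≤ R) :
    ∃ k : ℕ, 2 * volume {y ∈ annulus n (T / 2 ^ k) | u (x + y) < u x + inner ℝ p y -
        annulusConst n lam a * ((lowerC φ 1 + upperC φ 1) / lowerC φ T) * f x * (T / 2 ^ k) ^ 2} <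
      volume (ball (0 : E n) (T / 2 ^ k / 16)) := by
  have hf := h.pos_of_touching_point h1 h2 hlam hl hsub hout hx hux hp
  obtain ⟨hint, hpos, hle⟩ := h.touching_point_integral h1 h2 hlam hl hsub hout hx hux hp
  set M := annulusConst n lam a * ((lowerC φ 1 + upperC φ 1) / lowerC φ T) * f x
  have hM : 0 ≤ M := by
    have := annulusConst_pos n hlam (one_pos.trans_le h.one_le)
    have := h.lowerC_pos h2 one_pos
    have := h.lowerC_pos h2 hT
    have := h.upperC_nonneg zero_le_one
    positivity
  have hω := unitBallVolume_pos n
  obtain ⟨k, hk⟩ := h.exists_volume_annulus_lt h1.le h2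
    (fun y => neg_nonneg.2 (secondDiff_nonpos hout hx hux.le hp y)) hint hT hM (by positivity)
    (h.integral_lt_annulusConst_mul h1 h2 hlam hT hpos hle)
  refine ⟨k, ?_⟩
  have hsubset : {y ∈ annulus n (T / 2 ^ k) | u (x + y) < u x + inner ℝ p y - M * (T / 2 ^ k) ^ 2} ⊆
      {y ∈ annulus n (T / 2 ^ k) | M * (T / 2 ^ k) ^ 2 ≤ -secondDiff u x y} := by
    refine fun y hy => ⟨hy.1, ?_⟩
    have hyT : ‖y‖ ≤ T := hy.1.2.trans (div_le_self hT.le (one_le_pow₀ one_le_two))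
    have hsub_le := hp (x - y) (mem_ball_zero_iff.2 (by
      linarith [norm_sub_le x y, mem_ball_zero_iff.1 hx]))
    rw [sub_sub_cancel_left, inner_neg_right] at hsub_le
    rw [secondDiff]
    linarith [hy.2]
  calc 2 * volume _ ≤ 2 * volume _ := mul_le_mul_right (measure_mono hsubset) 2
    _ < 2 * ENNReal.ofReal _ := ENNReal.mul_lt_mul_right two_ne_zero ENNReal.ofNat_ne_top hk
    _ = volume (ball (0 : E n) (T / 2 ^ k / 16)) := by
      rw [volume_ball_eq _ (by positivity), ← ENNReal.ofReal_ofNat 2,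
        ← ENNReal.ofReal_mul zero_le_two, div_pow _ 16]
      congr 1
      field_simp

end GoodAnnulus

section Cubes

variable {n : ℕ}

/-- The closed cube with centre `c` and side length `s`, with sides parallel to the axes. -/
def closedCube (c : E n) (s : ℝ) : Set (E n) :=
  {y | ∀ i, |y i - c i| ≤ s / 2}

theorem closure_cube (c : E n) {s : ℝ} (hs : 0 < s) : closure (cube c s) = closedCube c s := by
  have hs' : 0 < s / 2 := by positivity
  have hopen : cube c s = PiLp.homeomorph 2 (fun _ : Fin n => ℝ) ⁻¹' ball c.ofLp (s / 2) := by
    ext y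
    simp only [cube, mem_preimage, mem_ball, dist_pi_lt_iff hs', Real.dist_eq]
    rfl
  have hclosed :
      closedCube c s = PiLp.homeomorph 2 (fun _ : Fin n => ℝ) ⁻¹' closedBall c.ofLp (s / 2) := by
    ext y
    simp only [closedCube, mem_preimage, mem_closedBall, dist_pi_le_iff hs'.le, Real.dist_eq]
    rfl
  rw [hopen, hclosed, ← Homeomorph.preimage_closure, closure_ball _ hs'.ne']

theorem ball_subset_cube (c : E n) (s : ℝ) : ball c (s / 2) ⊆ cube c s := by
  intro y hy i
  rw [mem_ball, dist_eq_norm] at hy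
  exact (PiLp.norm_apply_le (y - c) i).trans_lt hy

theorem closedCube_subset_closedBall (c : E n) {s : ℝ} (hs : 0 ≤ s) :
    closedCube c s ⊆ closedBall c (√n * s / 2) := by
  intro y hy
  rw [mem_closedBall, EuclideanSpace.dist_eq]
  refine Real.sqrt_le_iff.2 ⟨by positivity, ?_⟩
  calc ∑ i, dist (y i) (c i) ^ 2
      ≤ ∑ _i : Fin n, (s / 2) ^ 2 := by
        gcongr with i
        exact hy i
    _ = (√n * s / 2) ^ 2 := by
        rw [Finset.sum_const, Finset.card_univ, Fintype.card_fin, nsmul_eq_mul, div_pow, div_pow,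
          mul_pow, Real.sq_sqrt (by positivity)]
        ring

theorem cube_subset_closedBall (c : E n) {s : ℝ} (hs : 0 ≤ s) :
    cube c s ⊆ closedBall c (√n * s / 2) :=
  Subset.trans (fun _ hy i => (hy i).le) (closedCube_subset_closedBall c hs)

theorem diam_cube_le (c : E n) {s : ℝ} (hs : 0 ≤ s) : diam (cube c s) ≤ √n * s :=
  calc diam (cube c s)
      ≤ diam (closedBall c (√n * s / 2)) :=
        diam_mono (cube_subset_closedBall c hs) isBounded_closedBall
    _ ≤ 2 * (√n * s / 2) := diam_closedBall (by positivity)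
    _ = √n * s := by ring

theorem half_le_diam_cube [NeZero n] (c : E n) {s : ℝ} (hs : 0 < s) :
    s / 2 ≤ diam (cube c s) := by
  have hbounded : Bornology.IsBounded (cube c s) :=
    isBounded_closedBall.subset (cube_subset_closedBall c hs.le)
  set e : E n := EuclideanSpace.single 0 (s / 4) with he
  have hnorm : ‖e‖ = s / 4 := by
    rw [he, PiLp.norm_single, Real.norm_of_nonneg (by positivity)]
  have hadd : c + e ∈ cube c s := ball_subset_cube c s (by
    rw [mem_ball, dist_eq_norm, add_sub_cancel_left, hnorm]; linarith)
  have hsub : c - e ∈ cube c s := ball_subset_cube c s (by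
    rw [mem_ball, dist_eq_norm, sub_sub_cancel_left, norm_neg, hnorm]; linarith)
  refine le_trans (le_of_eq ?_) (dist_le_diam_of_mem hbounded hadd hsub)
  rw [dist_eq_norm, show c + e - (c - e) = (2 : ℝ) • e by module, norm_smul, hnorm,
    Real.norm_of_nonneg (by norm_num)]
  ring

theorem volume_cube_le (c : E n) {s : ℝ} (hs : 0 ≤ s) :
    volume (cube c s) ≤ ENNReal.ofReal ((√n * s / 2) ^ n * unitBallVolume n) := by
  rw [← volume_closedBall_eq c (by positivity)]
  exact measure_mono (cube_subset_closedBall c hs)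

theorem le_volume_cube (c : E n) {s : ℝ} (hs : 0 < s) :
    ENNReal.ofReal ((s / 2) ^ n * unitBallVolume n) ≤ volume (cube c s) := by
  rw [← volume_ball_eq c (by positivity)]
  exact measure_mono (ball_subset_cube c s)

end Cubes

section Grid

variable {n : ℕ}

/-- The index of the cube containing `y` in the grid `h ℤⁿ` of half-open cubes of side `h`. -/
noncomputable def gridIndex (h : ℝ) (y : E n) : Fin n → ℤ :=
  fun i => ⌊y i / h⌋

/-- The centre of the cube with index `k` in the grid of cubes of side `h`. -/
noncomputable def gridCenter (h : ℝ) (k : Fin n → ℤ) : E n :=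
  WithLp.toLp 2 fun i => ((k i : ℝ) + 1 / 2) * h

theorem mem_closedCube_gridCenter {h : ℝ} (hh : 0 < h) {k : Fin n → ℤ} {y : E n} :
    y ∈ closedCube (gridCenter h k) h ↔ ∀ i, (k i : ℝ) ≤ y i / h ∧ y i / h ≤ k i + 1 := by
  refine forall_congr' fun i => ?_
  rw [abs_le, le_div_iff₀ hh, div_le_iff₀ hh]
  simp only [gridCenter]
  constructor <;> rintro ⟨hl, hr⟩ <;> constructor <;> linarith

theorem mem_closedCube_gridIndex {h : ℝ} (hh : 0 < h) (y : E n) :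
    y ∈ closedCube (gridCenter h (gridIndex h y)) h :=
  (mem_closedCube_gridCenter hh).2 fun _ => ⟨Int.floor_le _, (Int.lt_floor_add_one _).le⟩

theorem gridIndex_eq_of_mem_cube {h : ℝ} (hh : 0 < h) {k : Fin n → ℤ} {y : E n}
    (hy : y ∈ cube (gridCenter h k) h) : gridIndex h y = k := by
  ext i
  have hyi := abs_lt.1 (hy i)
  simp only [gridCenter] at hyi
  rw [gridIndex, Int.floor_eq_iff, le_div_iff₀ hh, div_lt_iff₀ hh]
  constructor <;> linarith

theorem gridIndex_eq_of_le {s : ℝ} {i j : ℕ} (hij : i ≤ j) {y z : E n}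
    (h : gridIndex (s / 2 ^ j) y = gridIndex (s / 2 ^ j) z) :
    gridIndex (s / 2 ^ i) y = gridIndex (s / 2 ^ i) z := by
  have hcoarse (t : ℝ) : t / (s / 2 ^ i) = t / (s / 2 ^ j) / ((2 ^ (j - i) : ℕ) : ℝ) := by
    push_cast
    rw [div_div, div_mul_eq_mul_div, ← Nat.sub_add_cancel hij, pow_add, Nat.add_sub_cancel,
      mul_comm (2 ^ (j - i) : ℝ), mul_div_mul_right _ _ (by positivity)]
  ext l
  have hl : ⌊y l / (s / 2 ^ j)⌋ = ⌊z l / (s / 2 ^ j)⌋ := congrFun h l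
  rw [gridIndex, gridIndex, hcoarse, hcoarse, Int.floor_div_natCast, Int.floor_div_natCast, hl]

theorem eventually_mem_closedCube_gridIndex {h : ℝ} (hh : 0 < h) (x : E n) :
    ∀ᶠ y in 𝓝 x, x ∈ closedCube (gridCenter h (gridIndex h y)) h := by
  simp only [mem_closedCube_gridCenter hh, gridIndex]
  refine eventually_all.2 fun i => ?_
  have hcont : Tendsto (fun y : E n => y i / h) (𝓝 x) (𝓝 (x i / h)) :=
    (by fun_prop : Continuous fun y : E n => y i / h).tendsto x
  have hceil : (⌈x i / h⌉ : ℝ) - 1 < x i / h := by linarith [Int.ceil_lt_add_one (x i / h)]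
  filter_upwards [hcont.eventually (lt_mem_nhds hceil),
    hcont.eventually (gt_mem_nhds (Int.lt_floor_add_one (x i / h)))] with y hlow hupp
  constructor
  · have hle : ⌊y i / h⌋ ≤ ⌊x i / h⌋ :=
      Int.lt_add_one_iff.1 (Int.floor_lt.2 (by exact_mod_cast hupp))
    exact (Int.cast_le.2 hle).trans (Int.floor_le _)
  · have hle : ⌈x i / h⌉ - 1 ≤ ⌊y i / h⌋ := Int.le_floor.2 (by exact_mod_cast hlow.le)
    refine (Int.le_ceil _).trans ?_
    exact_mod_cast sub_le_iff_le_add.1 hle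

theorem finite_gridIndex_image {S : Set (E n)} (hS : Bornology.IsBounded S) {h : ℝ} (hh : 0 < h) :
    (gridIndex h '' S).Finite := by
  obtain ⟨r, hr⟩ := hS.subset_closedBall 0
  refine (finite_Icc (fun _ : Fin n => ⌊-r / h⌋) (fun _ => ⌊r / h⌋)).subset ?_
  rintro _ ⟨y, hy, rfl⟩
  have hcoord (i : Fin n) : |y i| ≤ r :=
    (PiLp.norm_apply_le y i).trans (mem_closedBall_zero_iff.1 (hr hy))
  constructor <;> intro i <;> refine Int.floor_le_floor ?_ <;> gcongr
  · exact (abs_le.1 (hcoord i)).1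
  · exact (abs_le.1 (hcoord i)).2

end Grid

section StoppingTime

variable {n : ℕ} {s₀ : ℝ} {S : Set (E n)} {P : ℕ → (Fin n → ℤ) → Prop}

/-- The dyadic cubes, given by their generation `k` (side length `s₀ / 2 ^ k`) and grid index, which
are the first with property `P` among the dyadic cubes containing some point of `S`. -/
def firstCubes (s₀ : ℝ) (S : Set (E n)) (P : ℕ → (Fin n → ℤ) → Prop) : Set (ℕ × (Fin n → ℤ)) :=
  {q | ∃ y ∈ S, gridIndex (s₀ / 2 ^ q.1) y = q.2 ∧ P q.1 q.2 ∧
    ∀ i < q.1, ¬ P i (gridIndex (s₀ / 2 ^ i) y)}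

theorem exists_mem_firstCubes {y : E n} (hy : y ∈ S)
    (hP : ∃ k, P k (gridIndex (s₀ / 2 ^ k) y)) :
    ∃ k, (k, gridIndex (s₀ / 2 ^ k) y) ∈ firstCubes s₀ S P := by
  classical
  exact ⟨Nat.find hP, y, hy, rfl, Nat.find_spec hP, fun _ => Nat.find_min hP⟩

theorem finite_firstCubes (hS : Bornology.IsBounded S) (hs₀ : 0 < s₀) {J : ℕ}
    (hJ : ∀ y ∈ S, ∃ k ≤ J, P k (gridIndex (s₀ / 2 ^ k) y)) : (firstCubes s₀ S P).Finite := by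
  have hfin : (⋃ k ∈ Iic J, Prod.mk k '' (gridIndex (s₀ / 2 ^ k) '' S)).Finite :=
    (finite_Iic J).biUnion fun k _ => (finite_gridIndex_image hS (by positivity)).image _
  refine hfin.subset ?_
  rintro ⟨k, z⟩ ⟨y, hy, hz, -, hfirst⟩
  obtain ⟨i, hiJ, hi⟩ := hJ y hy
  have hki : k ≤ i := not_lt.1 fun hik => hfirst i hik hi
  exact mem_iUnion₂.2 ⟨k, hki.trans hiJ, z, ⟨y, hy, hz⟩, rfl⟩

theorem eq_of_mem_cube_of_generation_le (hs₀ : 0 < s₀) {q q' : ℕ × (Fin n → ℤ)}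
    (hq : q ∈ firstCubes s₀ S P) (hq' : q' ∈ firstCubes s₀ S P) (hle : q.1 ≤ q'.1) {z : E n}
    (hz : z ∈ cube (gridCenter (s₀ / 2 ^ q.1) q.2) (s₀ / 2 ^ q.1))
    (hz' : z ∈ cube (gridCenter (s₀ / 2 ^ q'.1) q'.2) (s₀ / 2 ^ q'.1)) : q = q' := by
  obtain ⟨k, a⟩ := q
  obtain ⟨k', a'⟩ := q'
  obtain ⟨-, -, -, hP, -⟩ := hq
  obtain ⟨y', -, hy', -, hfirst'⟩ := hq'
  have hza : gridIndex (s₀ / 2 ^ k) z = a := gridIndex_eq_of_mem_cube (by positivity) hz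
  have hza' : gridIndex (s₀ / 2 ^ k') z = a' := gridIndex_eq_of_mem_cube (by positivity) hz'
  have hya : gridIndex (s₀ / 2 ^ k) y' = a :=
    (gridIndex_eq_of_le hle (hy'.trans hza'.symm)).trans hza
  obtain rfl : k = k' := hle.eq_of_not_lt fun hlt => hfirst' k hlt (hya ▸ hP)
  rw [← hza, ← hza']

theorem disjoint_of_mem_firstCubes (hs₀ : 0 < s₀) {q q' : ℕ × (Fin n → ℤ)}
    (hq : q ∈ firstCubes s₀ S P) (hq' : q' ∈ firstCubes s₀ S P) (hne : q ≠ q') :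
    Disjoint (cube (gridCenter (s₀ / 2 ^ q.1) q.2) (s₀ / 2 ^ q.1))
      (cube (gridCenter (s₀ / 2 ^ q'.1) q'.2) (s₀ / 2 ^ q'.1)) := by
  refine disjoint_left.2 fun z hz hz' => hne ?_
  rcases le_total q.1 q'.1 with hle | hle
  · exact eq_of_mem_cube_of_generation_le hs₀ hq hq' hle hz hz'
  · exact (eq_of_mem_cube_of_generation_le hs₀ hq' hq hle hz' hz).symm

theorem exists_generation_bound {Good : E n → ℝ → Prop} (hS : IsCompact S) (hs₀ : 0 < s₀)
    (hgood : ∀ x ∈ S, ∃ k : ℕ, ∀ c, x ∈ closure (cube c (s₀ / 2 ^ k)) → Good c (s₀ / 2 ^ k)) :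
    ∃ J : ℕ, ∀ y ∈ S, ∃ k ≤ J,
      Good (gridCenter (s₀ / 2 ^ k) (gridIndex (s₀ / 2 ^ k) y)) (s₀ / 2 ^ k) := by
  choose! κ hκ using hgood
  obtain ⟨t, htS, ht⟩ := hS.elim_nhds_subcover
    (fun x => {y | x ∈ closedCube (gridCenter (s₀ / 2 ^ κ x) (gridIndex (s₀ / 2 ^ κ x) y))
      (s₀ / 2 ^ κ x)})
    (fun x _ => eventually_mem_closedCube_gridIndex (by positivity) x)
  refine ⟨t.sup κ, fun y hy => ?_⟩
  obtain ⟨x, hxt, hxy⟩ := mem_iUnion₂.1 (ht hy)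
  refine ⟨κ x, Finset.le_sup hxt, hκ x (htS x hxt) _ ?_⟩
  rwa [closure_cube _ (by positivity)]

theorem exists_dyadic_cover {Good : E n → ℝ → Prop} (hS : IsCompact S) (hs₀ : 0 < s₀)
    (hgood : ∀ x ∈ S, ∃ k : ℕ, ∀ c, x ∈ closure (cube c (s₀ / 2 ^ k)) → Good c (s₀ / 2 ^ k)) :
    ∃ (m : ℕ) (c : Fin m → E n) (s : Fin m → ℝ),
      (∀ j, 0 < s j) ∧
      (∀ j, s j ≤ s₀) ∧
      (∀ i j, i ≠ j → Disjoint (cube (c i) (s i)) (cube (c j) (s j))) ∧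
      (∀ j, (S ∩ closure (cube (c j) (s j))).Nonempty) ∧
      (S ⊆ ⋃ j, closure (cube (c j) (s j))) ∧
      ∀ j, Good (c j) (s j) := by
  let P (k : ℕ) (z : Fin n → ℤ) : Prop := Good (gridCenter (s₀ / 2 ^ k) z) (s₀ / 2 ^ k)
  obtain ⟨J, hJ⟩ := exists_generation_bound hS hs₀ hgood
  have : Finite (firstCubes s₀ S P) := finite_firstCubes hS.isBounded hs₀ hJ
  obtain ⟨m, ⟨e⟩⟩ := Finite.exists_equiv_fin (firstCubes s₀ S P)
  have hmem (k : ℕ) (y : E n) :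
      y ∈ closure (cube (gridCenter (s₀ / 2 ^ k) (gridIndex (s₀ / 2 ^ k) y)) (s₀ / 2 ^ k)) := by
    rw [closure_cube _ (by positivity)]
    exact mem_closedCube_gridIndex (by positivity) y
  refine ⟨m, fun j => gridCenter (s₀ / 2 ^ (e.symm j).1.1) (e.symm j).1.2,
    fun j => s₀ / 2 ^ (e.symm j).1.1, fun j => by positivity,
    fun j => div_le_self hs₀.le (one_le_pow₀ one_le_two), ?_, ?_, ?_, ?_⟩
  · intro i j hij
    exact disjoint_of_mem_firstCubes hs₀ (e.symm i).2 (e.symm j).2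
      (Subtype.coe_injective.ne (e.symm.injective.ne hij))
  · intro j
    obtain ⟨y, hy, hindex, -⟩ := (e.symm j).2
    refine ⟨y, hy, ?_⟩
    simp only [← hindex]
    exact hmem _ y
  · intro y hy
    obtain ⟨k, hk⟩ := exists_mem_firstCubes (P := P) hy ((hJ y hy).imp fun _ h => h.2)
    refine mem_iUnion.2 ⟨e ⟨_, hk⟩, ?_⟩
    simp only [Equiv.symm_apply_apply]
    exact hmem k y
  · intro j
    obtain ⟨-, -, -, hP, -⟩ := (e.symm j).2
    exact hP

end StoppingTime

section LocalEstimates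

theorem exists_mem_notMem_sub_notMem {G : Type*} [MeasurableSpace G] [AddGroup G] [MeasurableAdd₂ G]
    [MeasurableNeg G] {μ : Measure G} [μ.IsAddLeftInvariant] [μ.IsNegInvariant] {b D : Set G}
    (g : G) (hb : 2 * μ b < μ D) : ∃ y ∈ D, y ∉ b ∧ g - y ∉ b := by
  by_contra! hcover
  refine hb.not_ge ?_
  calc μ D ≤ μ (b ∪ (fun y => g - y) ⁻¹' b) :=
        measure_mono fun y hy => or_iff_not_imp_left.2 (hcover y hy)
    _ ≤ μ b + μ ((fun y => g - y) ⁻¹' b) := measure_union_le _ _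
    _ = 2 * μ b := by
      rw [(μ.measurePreserving_sub_left g).measure_preimage_emb
        (MeasurableEquiv.subLeft g).measurableEmbedding, two_mul]

variable {n : ℕ} {u : E n → ℝ} {R r t N : ℝ} {x p : E n}

theorem mem_annulus_of_mem_ball {e w y : E n} (he : ‖e‖ = 3 / 4 * r) (hw : ‖w‖ < r / 8)
    (hy : y ∈ ball (w + e) (r / 16)) : y ∈ annulus n r := by
  rw [mem_ball, dist_eq_norm] at hy
  have hdist : |‖y‖ - ‖e‖| ≤ ‖y - (w + e)‖ + ‖w‖ :=
    calc |‖y‖ - ‖e‖| ≤ ‖y - e‖ := abs_norm_sub_norm_le y e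
      _ = ‖y - (w + e) + w‖ := by congr 1; abel
      _ ≤ ‖y - (w + e)‖ + ‖w‖ := norm_add_le _ _
  obtain ⟨hlow, hupp⟩ := abs_le.1 hdist
  constructor <;> linarith

theorem gradImage_subset_closedBall {Γ : E n → ℝ} {U S : Set (E n)} (hr : 0 < r)
    (hU : ball x (r / 8) ⊆ U) (hS : S ⊆ closedBall x (r / 16))
    (hup : ∀ y ∈ U, Γ y ≤ t + inner ℝ p (y - x))
    (hlow : ∀ y ∈ ball x (r / 8), t + inner ℝ p (y - x) - N ≤ Γ y) :
    gradImage Γ U S ⊆ closedBall p (32 * N / r) := by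
  rintro q ⟨w, ⟨hwS, hwU⟩, hq⟩
  have hwx := hS hwS
  rw [mem_closedBall, dist_eq_norm] at hwx
  have hinner (d : E n) (hd : ‖d‖ ≤ r / 32) : inner ℝ (p - q) d ≤ N := by
    have hwd : w + d ∈ ball x (r / 8) := by
      rw [mem_ball, dist_eq_norm, add_sub_right_comm]
      linarith [norm_add_le (w - x) d]
    have hlow_wd := hlow _ hwd
    have hq_wd := hq _ (hU hwd)
    rw [add_sub_cancel_left] at hq_wd
    rw [add_sub_right_comm w d x, inner_add_right] at hlow_wd
    rw [inner_sub_left]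
    linarith [hup w hwU]
  rw [mem_closedBall, dist_comm, dist_eq_norm]
  calc ‖p - q‖ ≤ N / (r / 32) := norm_le_div_of_forall_inner_le (by positivity) hinner
    _ = 32 * N / r := by field_simp

theorem closedBall_subset_ball_three_mul (hx : x ∈ ball (0 : E n) R) (hr : r ≤ R) :
    closedBall x r ⊆ ball 0 (3 * R) := by
  rw [mem_ball] at hx
  exact closedBall_subset_ball' (by linarith [pos_of_mem_ball hx])

variable [NeZero n]

theorem norm_single_three_quarters (hr : 0 < r) :
    ‖(EuclideanSpace.single 0 (3 / 4 * r) : E n)‖ = 3 / 4 * r := by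
  rw [PiLp.norm_single, Real.norm_of_nonneg (by positivity)]

-- A point `z` near `x` is the midpoint of two points of the annulus about `x` where `u` is good.
theorem plane_sub_le_concaveEnvelope (hB : BddAbove (range u)) (hr : 0 < r)
    (hball : closedBall x r ⊆ ball 0 (3 * R))
    (hbad : 2 * volume {y ∈ annulus n r | u (x + y) < t + inner ℝ p y - N} <
      volume (ball (0 : E n) (r / 16)))
    {z : E n} (hz : z ∈ ball x (r / 8)) :
    t + inner ℝ p (z - x) - N ≤ concaveEnvelope u R z := by
  set e : E n := EuclideanSpace.single 0 (3 / 4 * r)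
  set w := z - x with hw
  have hwr : ‖w‖ < r / 8 := by rwa [mem_ball, dist_eq_norm] at hz
  have he : ‖e‖ = 3 / 4 * r := norm_single_three_quarters hr
  rw [← Measure.addHaar_ball_center volume (w + e)] at hbad
  obtain ⟨y, hyball, hy, hy'⟩ := exists_mem_notMem_sub_notMem ((2 : ℝ) • w) hbad
  have hyball' : (2 : ℝ) • w - y ∈ ball (w + -e) (r / 16) := by
    rw [mem_ball, dist_eq_norm] at hyball ⊢
    rwa [show (2 : ℝ) • w - y - (w + -e) = -(y - (w + e)) by module, norm_neg]
  have hgood {v : E n} (hv : v ∈ annulus n r)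
      (hvbad : v ∉ {y ∈ annulus n r | u (x + y) < t + inner ℝ p y - N}) :
      x + v ∈ ball (0 : E n) (3 * R) ∧ t + inner ℝ p v - N ≤ concaveEnvelope u R (x + v) := by
    have hmem : x + v ∈ ball (0 : E n) (3 * R) :=
      hball (by rw [mem_closedBall, dist_eq_norm, add_sub_cancel_left]; exact hv.2)
    exact ⟨hmem, (not_lt.1 fun hlt => hvbad ⟨hv, hlt⟩).trans
      ((le_max_left _ _).trans (max_le_concaveEnvelope hB hmem))⟩
  obtain ⟨hmem, hle⟩ := hgood (mem_annulus_of_mem_ball he hwr hyball) hy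
  obtain ⟨hmem', hle'⟩ :=
    hgood (mem_annulus_of_mem_ball ((norm_neg e).trans he) hwr hyball') hy'
  have hconc := (concaveOn_concaveEnvelope (R := R) hB).2 hmem hmem'
    one_half_pos.le one_half_pos.le (add_halves 1)
  have hmid : (1 / 2 : ℝ) • (x + y) + (1 / 2 : ℝ) • (x + ((2 : ℝ) • w - y)) = z := by
    rw [hw]; module
  rw [hmid, smul_eq_mul, smul_eq_mul] at hconc
  rw [inner_sub_right, inner_smul_right] at hle'
  linarith

theorem volume_ball_le_two_mul_volume (hr : 0 < r) (hball : closedBall x r ⊆ ball 0 (3 * R))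
    (hp : ∀ y ∈ ball (0 : E n) (3 * R), max (u y) 0 ≤ t + inner ℝ p (y - x))
    (hbad : 2 * volume {y ∈ annulus n r | u (x + y) < t + inner ℝ p y - N} <
      volume (ball (0 : E n) (r / 16))) :
    volume (ball (0 : E n) (r / 16)) ≤
      2 * volume {y ∈ ball x (7 / 8 * r) | concaveEnvelope u R y - N ≤ u y} := by
  set b := {y ∈ annulus n r | u (x + y) < t + inner ℝ p y - N}
  set G := {y ∈ ball x (7 / 8 * r) | concaveEnvelope u R y - N ≤ u y}
  set e : E n := EuclideanSpace.single 0 (3 / 4 * r)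
  have he : ‖e‖ = 3 / 4 * r := norm_single_three_quarters hr
  have hcover : ball e (r / 16) ⊆ b ∪ (fun y => x + y) ⁻¹' G := by
    refine fun y hy => or_iff_not_imp_left.2 fun hyb => ?_
    have hyr : y ∈ annulus n r := mem_annulus_of_mem_ball he (w := 0) (by simpa) (by rwa [zero_add])
    have hxy : x + y ∈ ball (0 : E n) (3 * R) :=
      hball (by rw [mem_closedBall, dist_eq_norm, add_sub_cancel_left]; exact hyr.2)
    have hplane := concaveEnvelope_le hp hxy
    rw [add_sub_cancel_left] at hplane
    rw [mem_ball, dist_eq_norm] at hy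
    refine ⟨?_, by linarith [not_lt.1 fun hlt => hyb ⟨hyr, hlt⟩]⟩
    rw [mem_ball, dist_eq_norm, add_sub_cancel_left]
    linarith [norm_sub_norm_le y e]
  have hvolume : volume (ball (0 : E n) (r / 16)) ≤ volume b + volume G := by
    rw [← Measure.addHaar_ball_center volume e, ← measure_preimage_add volume x G]
    exact (measure_mono hcover).trans (measure_union_le _ _)
  by_contra! hG
  refine (ENNReal.add_lt_add hbad hG).not_ge ?_
  rw [← mul_add, ← two_mul]
  exact mul_le_mul_right hvolume 2

end LocalEstimates

section GoodCubes

variable {n : ℕ} [NeZero n] {u f : E n → ℝ} {R s t K : ℝ} {x p c : E n}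

theorem volume_gradImage_closure_cube_le (hB : BddAbove (range u)) (hs : 0 < s)
    (hball : closedBall x (16 * √n * s) ⊆ ball 0 (3 * R))
    (hp : ∀ y ∈ ball (0 : E n) (3 * R), max (u y) 0 ≤ t + inner ℝ p (y - x))
    (hbad : 2 * volume {y ∈ annulus n (16 * √n * s) |
        u (x + y) < t + inner ℝ p y - K * (16 * √n * s) ^ 2} <
      volume (ball (0 : E n) (16 * √n * s / 16)))
    (hK : 0 ≤ K) (hc : x ∈ closure (cube c s)) :
    volume (gradImage (concaveEnvelope u R) (ball 0 (3 * R)) (closure (cube c s))) ≤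
      ENNReal.ofReal ((1024 * √n * K) ^ n) * volume (cube c s) := by
  have : (0 : ℝ) < n := mod_cast NeZero.pos n
  set r := 16 * √n * s with hr
  have hr0 : 0 < r := by positivity
  rw [closure_cube _ hs] at hc ⊢
  have hcube : closedCube c s ⊆ closedBall x (r / 16) := fun y hy => by
    have hyc := closedCube_subset_closedBall c hs.le hy
    have hxc := closedCube_subset_closedBall c hs.le hc
    rw [mem_closedBall] at *
    linarith [dist_triangle_right y x c]
  have hgrad := gradImage_subset_closedBall hr0
    (ball_subset_closedBall.trans ((closedBall_subset_closedBall (by linarith)).trans hball)) hcube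
    (fun y hy => concaveEnvelope_le hp hy)
    (fun y hy => plane_sub_le_concaveEnvelope hB hr0 hball hbad hy)
  calc volume (gradImage (concaveEnvelope u R) (ball 0 (3 * R)) (closedCube c s))
      ≤ volume (closedBall p (32 * (K * r ^ 2) / r)) := measure_mono hgrad
    _ = ENNReal.ofReal ((1024 * √n * K) ^ n * ((s / 2) ^ n * unitBallVolume n)) := by
        rw [volume_closedBall_eq _ (by positivity), ← mul_assoc (_ ^ n), ← mul_pow]
        congr 3
        rw [hr]
        field_simp
        ring
    _ = ENNReal.ofReal ((1024 * √n * K) ^ n) * ENNReal.ofReal ((s / 2) ^ n * unitBallVolume n) :=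
        ENNReal.ofReal_mul (by positivity)
    _ ≤ ENNReal.ofReal ((1024 * √n * K) ^ n) * volume (cube c s) := by
        gcongr
        exact le_volume_cube c hs

theorem sq_side_le_diam_cube_sq (c : E n) (hs : 0 < s) :
    (16 * √n * s) ^ 2 ≤ 1024 * n * diam (cube c s) ^ 2 :=
  calc (16 * √n * s) ^ 2 = 1024 * n * (s / 2) ^ 2 := by
        rw [mul_pow, mul_pow, Real.sq_sqrt (by positivity)]
        ring
    _ ≤ 1024 * n * diam (cube c s) ^ 2 := by
        gcongr
        exact half_le_diam_cube c hs

theorem half_volume_cube_le (hs : 0 < s) (hball : closedBall x (16 * √n * s) ⊆ ball 0 (3 * R))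
    (hp : ∀ y ∈ ball (0 : E n) (3 * R), max (u y) 0 ≤ t + inner ℝ p (y - x))
    (hbad : 2 * volume {y ∈ annulus n (16 * √n * s) |
        u (x + y) < t + inner ℝ p y - K * (16 * √n * s) ^ 2} <
      volume (ball (0 : E n) (16 * √n * s / 16)))
    (hK : 0 ≤ K) (hc : x ∈ closure (cube c s)) :
    ENNReal.ofReal (1 / 2) * volume (cube c s) ≤
      volume {y ∈ cube c (32 * √n * s) |
        concaveEnvelope u R y - 1024 * n * K * diam (cube c s) ^ 2 ≤ u y} := by
  have : (0 : ℝ) < n := mod_cast NeZero.pos n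
  set r := 16 * √n * s with hr
  have hr0 : 0 < r := by positivity
  rw [closure_cube _ hs] at hc
  have hxc := mem_closedBall.1 (closedCube_subset_closedBall c hs.le hc)
  have hgood : {y ∈ ball x (7 / 8 * r) | concaveEnvelope u R y - K * r ^ 2 ≤ u y} ⊆
      {y ∈ cube c (32 * √n * s) |
        concaveEnvelope u R y - 1024 * n * K * diam (cube c s) ^ 2 ≤ u y} := by
    rintro y ⟨hyx, hy⟩
    refine ⟨ball_subset_cube c _ ?_, ?_⟩
    · rw [mem_ball] at hyx ⊢
      linarith [dist_triangle y x c]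
    · have := mul_le_mul_of_nonneg_left (sq_side_le_diam_cube_sq c hs) hK
      linarith
  calc ENNReal.ofReal (1 / 2) * volume (cube c s)
      ≤ ENNReal.ofReal (1 / 2) * volume (ball (0 : E n) (r / 16)) := by
        rw [volume_ball_eq _ (by positivity)]
        refine mul_le_mul_right ((volume_cube_le c hs.le).trans (ENNReal.ofReal_le_ofReal ?_)) _
        exact mul_le_mul_of_nonneg_right (pow_le_pow_left₀ (by positivity) (by linarith) n)
          (unitBallVolume_pos n).le
    _ ≤ ENNReal.ofReal (1 / 2) * (2 * volume _) :=
        mul_le_mul_right (volume_ball_le_two_mul_volume hr0 hball hp hbad) _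
    _ = volume {y ∈ ball x (7 / 8 * r) | concaveEnvelope u R y - K * r ^ 2 ≤ u y} := by
        rw [← mul_assoc, one_div, ENNReal.ofReal_inv_of_pos two_pos, ENNReal.ofReal_ofNat,
          ENNReal.inv_mul_cancel two_ne_zero ENNReal.ofNat_ne_top, one_mul]
    _ ≤ volume _ := measure_mono hgood

/-- The two estimates of the ABP theorem for the cube with centre `c` and side length `s`; `A` is
the factor `(C̲ + C̄) / C̲(T)` at the scale `T` that bounds the size of the cubes. -/
structure IsGoodCube (u f : E n → ℝ) (R C A : ℝ) (c : E n) (s : ℝ) : Prop where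
  volume_gradImage_le :
    volume (gradImage (concaveEnvelope u R) (ball 0 (3 * R)) (closure (cube c s))) ≤
      ENNReal.ofReal (C * (A * sSup (f '' (closure (cube c s) ∩ ball 0 R))) ^ n) *
        volume (cube c s)
  half_volume_le :
    ENNReal.ofReal (1 / 2) * volume (cube c s) ≤
      volume {y | y ∈ cube c (32 * √n * s) ∧
        concaveEnvelope u R y - C * A * sSup (f '' (closure (cube c s) ∩ ball 0 R)) *
          diam (cube c s) ^ 2 < u y}

/-- The constant of the ABP theorem. The two summands bound the superdifferential image and the
distance of `u` from its concave envelope, respectively. -/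
noncomputable def abpConst (n : ℕ) (lam a : ℝ) : ℝ :=
  (1024 * √n * annulusConst n lam a) ^ n + 2048 * n * annulusConst n lam a

theorem abpConst_pos (n : ℕ) [NeZero n] {lam a : ℝ} (hlam : 0 < lam) (ha : 0 < a) :
    0 < abpConst n lam a := by
  have : (0 : ℝ) < n := mod_cast NeZero.pos n
  have := annulusConst_pos n hlam ha
  unfold abpConst
  positivity

theorem isGoodCube_of_volume_annulus_lt {lam a A : ℝ} (hlam : 0 < lam) (ha : 0 < a) (hA : 0 < A)
    (hB : BddAbove (range u)) (hf : BddAbove (f '' ball 0 R)) (hx : x ∈ ball (0 : E n) R)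
    (hp : ∀ y ∈ ball (0 : E n) (3 * R), max (u y) 0 ≤ t + inner ℝ p (y - x))
    (hs : 0 < s) (hsR : 16 * √n * s ≤ R) (hfx : 0 < f x)
    (hbad : 2 * volume {y ∈ annulus n (16 * √n * s) |
        u (x + y) < t + inner ℝ p y - annulusConst n lam a * A * f x * (16 * √n * s) ^ 2} <
      volume (ball (0 : E n) (16 * √n * s / 16)))
    (hc : x ∈ closure (cube c s)) : IsGoodCube u f R (abpConst n lam a) A c s := by
  have : (0 : ℝ) < n := mod_cast NeZero.pos n
  have hκ := annulusConst_pos n hlam ha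
  set κ := annulusConst n lam a with hκdef
  set M := sSup (f '' (closure (cube c s) ∩ ball 0 R))
  have hfM : f x ≤ M := le_csSup (hf.mono (image_mono inter_subset_right)) ⟨x, ⟨hc, hx⟩, rfl⟩
  have hM0 : 0 < M := hfx.trans_le hfM
  have hball := closedBall_subset_ball_three_mul hx hsR
  have hbadM : 2 * volume {y ∈ annulus n (16 * √n * s) |
        u (x + y) < t + inner ℝ p y - κ * A * M * (16 * √n * s) ^ 2} <
      volume (ball (0 : E n) (16 * √n * s / 16)) := by
    refine lt_of_le_of_lt ?_ hbad
    gcongr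
  constructor
  · refine (volume_gradImage_closure_cube_le hB hs hball hp hbadM (by positivity) hc).trans ?_
    gcongr
    calc (1024 * √n * (κ * A * M)) ^ n = (1024 * √n * κ) ^ n * (A * M) ^ n := by
          rw [← mul_pow]
          ring
      _ ≤ abpConst n lam a * (A * M) ^ n := by
          gcongr
          exact le_add_of_nonneg_right (by positivity)
  · refine (half_volume_cube_le hs hball hp hbadM (by positivity) hc).trans
      (measure_mono fun y hy => ⟨hy.1, lt_of_lt_of_le ?_ hy.2⟩)
    have hdiam : 0 < diam (cube c s) := (half_pos hs).trans_le (half_le_diam_cube c hs)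
    refine sub_lt_sub_left (mul_lt_mul_of_pos_right ?_ (by positivity)) _
    calc 1024 * n * (κ * A * M) = 1024 * n * κ * (A * M) := by ring
      _ < abpConst n lam a * (A * M) := by
          gcongr
          rw [abpConst, ← hκdef]
          linarith [show 0 < n * κ by positivity, show 0 < (1024 * √n * κ) ^ n by positivity]
      _ = abpConst n lam a * A * M := by ring

theorem WeakScaling.exists_isGoodCube {φ : ℝ → ℝ} {a σ₁ σ₂ lam Lam T : ℝ}
    (h : WeakScaling φ a σ₁ σ₂) (h1 : 0 < σ₁) (h2 : σ₂ < 2) (hlam : 0 < lam) (hl : lam ≤ Lam)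
    (hT : 0 < T) (hTR : T ≤ R) (hB : BddAbove (range u)) (hf : BddAbove (f '' ball 0 R))
    (hsub : IsViscositySubsolution (maxOp φ lam Lam) (fun x => -f x) (ball 0 R) u)
    (hout : ∀ x, x ∉ ball (0 : E n) R → u x ≤ 0) (hpos : ∃ x, 0 < u x)
    (hx : x ∈ contactSet u R) :
    ∃ k : ℕ, ∀ c, x ∈ closure (cube c (T / (16 * √n) / 2 ^ k)) →
      IsGoodCube u f R (abpConst n lam a) ((lowerC φ 1 + upperC φ 1) / lowerC φ T) c
        (T / (16 * √n) / 2 ^ k) := by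
  have : (0 : ℝ) < n := mod_cast NeZero.pos n
  have hux : 0 < u x := contactSet_pos hB hout hpos hx
  obtain ⟨hxR, hxΓ⟩ := hx
  obtain ⟨p, hp⟩ := exists_supporting_plane hB
    (ball_subset_ball (by linarith : R ≤ 3 * R) hxR)
  rw [← hxΓ] at hp
  have hup (y : E n) (hy : y ∈ ball (0 : E n) (3 * R)) : u y ≤ u x + inner ℝ p (y - x) :=
    (le_max_left _ _).trans (hp y hy)
  obtain ⟨k, hk⟩ := h.exists_good_annulus h1 h2 hlam hl hsub hout hxR hux hup hT hTR
  have hA : 0 < (lowerC φ 1 + upperC φ 1) / lowerC φ T :=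
    div_pos (add_pos_of_pos_of_nonneg (h.lowerC_pos h2 one_pos) (h.upperC_nonneg zero_le_one))
      (h.lowerC_pos h2 hT)
  have hside : 16 * √n * (T / (16 * √n) / 2 ^ k) = T / 2 ^ k := by field_simp
  rw [← hside] at hk
  refine ⟨k, fun c hc => isGoodCube_of_volume_annulus_lt hlam (one_pos.trans_le h.one_le) hA hB hf
    hxR hp (by positivity) ?_ (h.pos_of_touching_point h1 h2 hlam hl hsub hout hxR hux hup) hk hc⟩
  rw [hside]
  exact (div_le_self hT.le (one_le_pow₀ one_le_two)).trans hTR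

end GoodCubes

theorem r0_pos (n : ℕ) [NeZero n] (σ : ℝ) {R : ℝ} (hR : 0 < R) : 0 < r0 n σ R := by
  have : (0 : ℝ) < n := mod_cast NeZero.pos n
  unfold r0
  positivity

theorem r0_le (n : ℕ) [NeZero n] {σ R : ℝ} (hσ : σ < 2) (hR : 0 < R) : r0 n σ R ≤ R := by
  have hn : (1 : ℝ) ≤ n := mod_cast NeZero.one_le
  have hpow : (2 : ℝ) ^ (-1 / (2 - σ)) ≤ 1 := Real.rpow_le_one_of_one_le_of_nonpos one_le_two
    (div_nonpos_of_nonpos_of_nonneg (by norm_num) (by linarith))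
  have hdiv : 1 / (2 ^ 8 * (n : ℝ)) ≤ 1 := by
    rw [div_le_one (by positivity)]
    linarith
  calc r0 n σ R ≤ 1 * 1 * R := by unfold r0; gcongr
    _ = R := by ring

end NonlocalABP

open NonlocalABP in
theorem theoremt_general {n : ℕ} [NeZero n] {lam Lam a σ₁ σ₂ R T : ℝ} {φ : ℝ → ℝ} {u f : E n → ℝ}
    (hlam : 0 < lam) (hl : lam ≤ Lam) (h1 : 0 < σ₁) (h2 : σ₂ < 2) (h : WeakScaling φ a σ₁ σ₂)
    (hT : 0 < T) (hTR : T ≤ R) (hf : BddAbove (f '' Metric.ball 0 R))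
    (hsub : IsViscositySubsolution (maxOp φ lam Lam) (fun x => -f x) (Metric.ball 0 R) u)
    (hout : ∀ x, x ∉ Metric.ball (0 : E n) R → u x ≤ 0) (hpos : ∃ x, 0 < u x) :
    ∃ (m : ℕ) (c : Fin m → E n) (s : Fin m → ℝ),
      (∀ j, 0 < s j) ∧
      (∀ i j, i ≠ j → Disjoint (cube (c i) (s i)) (cube (c j) (s j))) ∧
      (∀ j, Metric.diam (cube (c j) (s j)) ≤ T) ∧
      (∀ j, (contactSet u R ∩ closure (cube (c j) (s j))).Nonempty) ∧
      (contactSet u R ⊆ ⋃ j, closure (cube (c j) (s j))) ∧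
      ∀ j, IsGoodCube u f R (abpConst n lam a) ((lowerC φ 1 + upperC φ 1) / lowerC φ T)
        (c j) (s j) := by
  have : (0 : ℝ) < n := mod_cast NeZero.pos n
  obtain ⟨B, hB⟩ := hsub.bounded
  have hbdd : BddAbove (Set.range u) :=
    ⟨B, Set.forall_mem_range.2 fun x => (le_abs_self _).trans (hB x)⟩
  obtain ⟨m, c, s, hs, hside, hdisj, hne, hcov, hgood⟩ := exists_dyadic_cover
    (isCompact_contactSet hbdd (hT.trans_le hTR) hsub.usc hout hpos)
    (by positivity : 0 < T / (16 * √n))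
    fun x hx => h.exists_isGoodCube h1 h2 hlam hl hT hTR hbdd hf hsub hout hpos hx
  refine ⟨m, c, s, hs, hdisj, fun j => ?_, hne, hcov, hgood⟩
  calc Metric.diam (cube (c j) (s j)) ≤ √n * s j := diam_cube_le _ (hs j).le
    _ ≤ √n * (T / (16 * √n)) := by gcongr; exact hside j
    _ = T / 16 := by field_simp
    _ ≤ T := by linarith

theorem theoremt (n : ℕ) [NeZero n] :
    ∃ μ : ℝ, μ ∈ Set.Ioo (0 : ℝ) 1 ∧
    ∀ lam a : ℝ, 0 < lam → 1 ≤ a →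
    ∃ C : ℝ, 0 < C ∧
    ∀ (Lam σ₁ σ₂ : ℝ) (φ : ℝ → ℝ), lam ≤ Lam → 0 < σ₁ → σ₁ ≤ σ₂ → σ₂ < 2 →
      NonlocalABP.WeakScaling φ a σ₁ σ₂ →
    ∀ (R : ℝ) (u f : NonlocalABP.E n → ℝ), 0 < R →
      BddAbove (f '' Metric.ball 0 R) →
      NonlocalABP.IsViscositySubsolution (NonlocalABP.maxOp φ lam Lam) (fun x => -f x)
        (Metric.ball 0 R) u →
      (∀ x, x ∉ Metric.ball (0 : NonlocalABP.E n) R → u x ≤ 0) →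
      (∃ x, 0 < u x) →
    ∃ (m : ℕ) (c : Fin m → NonlocalABP.E n) (s : Fin m → ℝ),
      (∀ j, 0 < s j) ∧
      (∀ i j, i ≠ j →
        Disjoint (NonlocalABP.cube (c i) (s i)) (NonlocalABP.cube (c j) (s j))) ∧
      (∀ j, Metric.diam (NonlocalABP.cube (c j) (s j)) ≤ NonlocalABP.r0 n σ₁ R) ∧
      (∀ j, (NonlocalABP.contactSet u R ∩ closure (NonlocalABP.cube (c j) (s j))).Nonempty) ∧
      (NonlocalABP.contactSet u R ⊆ ⋃ j, closure (NonlocalABP.cube (c j) (s j))) ∧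
      (∀ j,
        MeasureTheory.volume
          (NonlocalABP.gradImage (NonlocalABP.concaveEnvelope u R) (Metric.ball 0 (3 * R))
            (closure (NonlocalABP.cube (c j) (s j)))) ≤
        ENNReal.ofReal (C * (NonlocalABP.scaleFactor n φ σ₁ R *
            sSup (f '' (closure (NonlocalABP.cube (c j) (s j)) ∩ Metric.ball 0 R))) ^ n) *
          MeasureTheory.volume (NonlocalABP.cube (c j) (s j))) ∧
      (∀ j,
        ENNReal.ofReal μ * MeasureTheory.volume (NonlocalABP.cube (c j) (s j)) ≤
        MeasureTheory.volume
          {y | y ∈ NonlocalABP.cube (c j) (32 * Real.sqrt n * s j) ∧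
            NonlocalABP.concaveEnvelope u R y -
              C * NonlocalABP.scaleFactor n φ σ₁ R *
                sSup (f '' (closure (NonlocalABP.cube (c j) (s j)) ∩ Metric.ball 0 R)) *
                Metric.diam (NonlocalABP.cube (c j) (s j)) ^ 2 < u y}) := by
  refine ⟨1 / 2, by norm_num, fun lam a hlam ha => ⟨NonlocalABP.abpConst n lam a,
    NonlocalABP.abpConst_pos n hlam (one_pos.trans_le ha), ?_⟩⟩
  intro Lam σ₁ σ₂ φ hl h1 h12 h2 h R u f hR hf hsub hout hpos
  obtain ⟨m, c, s, hs, hdisj, hdiam, hne, hcov, hgood⟩ := theoremt_general hlam hl h1 h2 h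
    (NonlocalABP.r0_pos n σ₁ hR) (NonlocalABP.r0_le n (h12.trans_lt h2) hR) hf hsub hout hpos
  exact ⟨m, c, s, hs, hdisj, hdiam, hne, hcov, fun j => (hgood j).volume_gradImage_le,
    fun j => (hgood j).half_volume_le⟩
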